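/- **Setting.** Let $\psi^{(1)},\psi^{(2)}$ be bounded, compactly supported orthonormal wavelets on $\mathbb R$ (with compactly supported bounded scaling functions) having $s_{1o}\ge s_1$ and $s_{2o}\ge s_2$ vanishing moments, and let $\psi^{(i)}_{j,k}$, $j\ge 0$, $0\le k<2^j$, be the corresponding periodized wavelets on $[0,1]$. One observes $(t_i,x_i,y_i)$, $i=1,\dots,N$, with $$y_i=U(t_i,x_i)+\sigma\varepsilon_i,\qquad U(t,x)=\beta_o+f(t)+g(x),$$ where $\sigma>0$ is constant, the $t_i$ are i.i.d. with known density $h_1$ on $[0,1]$, the $x_i$ are i.i.d. with known density $h_2$ on $[0,1]$, the sequences $(t_i)$, $(x_i)$ and the noise are independent, and $m_{11}\le h_1\le m_{12}$, $m_{21}\le h_2\le m_{22}$ on $[0,1)$ for positive constants $m_{il}$. The noise is $\varepsilon_i=\sum_{m\ge0}a_m\eta_{i-m}$ with i.i.d. centred nondegenerate Gaussian $\eta_k$, $a_0=1$, $\lim_{m\to\infty}a_m m^{(\alpha+1)/2}=1$ for some $\alpha\in(0,1)$, and $\mathrm{Var}\bigl(\sum_{i=1}^N\varepsilon_i\bigr)\sim\pi_\alpha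 N^{2-\alpha}$ with $0<\pi_\alpha<\infty$. Its spectral density $d$ satisfies $d(u)\ge c|u|^{\alpha-1}$ for almost every $u\in[-\pi,\pi]$, for some $c>0$. Let $1\le p,q\le\infty$ and $A_1,A_2,M_1,M_2>0$. Let $B^{s_1,s_2}_{p,q}(A)$ be the set of all $U(t,x)=\beta_o+f(t)+g(x)$ with $\beta_o\in\mathbb R\setminus\{0\}$ and $f,g\in L^2([0,1])$ such that $f\le M_1$, $g\le M_2$, $\int_0^1 f=\int_0^1 g=0$ and, with $\beta^{(1)}_{j,k}=\int_0^1 f\psi^{(1)}_{j,k}$, $\beta^{(2)}_{j,k}=\int_0^1 g\psi^{(2)}_{j,k}$ and $s_i^*=s_i+\frac12-\frac1p$, $$\Bigl(\sum_{j\ge0}2^{js_i^*q}\Bigl(\sum_{k=0}^{2^j-1}|\beta^{(i)}_{j,k}|^p\Bigr)^{q/p}\Bigr)^{1/q}\le A_i,\qquad i=1,2$$ (suprema if $p=\infty$ or $q=\infty$). Let $$R_N=\inf_{\tilde U}\ \sup_{U\in B^{s_1,s_2}_{p,q}(A)}\mathbb E\|\tilde U-U\|^2_{L^2([0,1]^2)},$$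 the infimum being over all estimators $\tilde U$ based on the $N$ observations. **Theorem.** If $\min\{s_1,s_2\}\ge\max\{\frac1p,\frac12\}$, then there is a constant $C>0$, independent of $N,A_1,A_2,M_1,M_2$ and depending on the design densities only through the constants $m_{il}$, such that for all sufficiently large $N$ $$R_N\ \ge\ C\begin{cases}A_2^2\Bigl[\dfrac1{A_2^2N}\Bigr]^{\frac{2s_2}{2s_2+1}}\vee\dfrac1{N^{\alpha}}, & s_1>s_2,\\[2mm] A_1^2\Bigl[\dfrac1{A_1^2N}\Bigr]^{\frac{2s_1}{2s_1+1}}\vee\dfrac1{N^{\alpha}}, & s_1\le s_2.\end{cases}$$ -/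

import Mathlib

open MeasureTheory ProbabilityTheory Filter Topology
open scoped ENNReal NNReal

noncomputable section

/-! ### Compactly supported wavelets and their periodization to the unit interval -/

/-- The dilated and translated function `2^{j/2} ψ(2^j x - k)`. -/
def dyadic (ψ : ℝ → ℝ) (j : ℕ) (k : ℤ) (x : ℝ) : ℝ :=
  Real.sqrt (2 ^ j) * ψ (2 ^ j * x - k)

/-- The family `φ(· - k)`, `k ∈ ℤ`, together with `2^{j/2} ψ(2^j · - k)`, `j ≥ 0`, `k ∈ ℤ`. -/
def waveletFamily (φ ψ : ℝ → ℝ) : ℤ ⊕ (ℕ × ℤ) → ℝ → ℝ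
  | Sum.inl k => fun x => φ (x - k)
  | Sum.inr jk => dyadic ψ jk.1 jk.2

/-- `ψ` is a bounded, compactly supported orthonormal wavelet with scaling function `φ`: the
integer translates of `φ` and the dyadic dilates and translates of `ψ` at levels `j ≥ 0` form
an orthonormal basis of `L²(ℝ)`. -/
structure IsWaveletPair (φ ψ : ℝ → ℝ) : Prop where
  measurable_scaling : Measurable φ
  measurable_wavelet : Measurable ψ
  compactSupport_scaling : HasCompactSupport φ
  compactSupport_wavelet : HasCompactSupport ψ
  bounded_scaling : ∃ B : ℝ, ∀ x, |φ x| ≤ B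
  bounded_wavelet : ∃ B : ℝ, ∀ x, |ψ x| ≤ B
  integral_scaling : ∫ x, φ x = 1
  orthonormal : ∀ a b : ℤ ⊕ (ℕ × ℤ),
    ∫ x, waveletFamily φ ψ a x * waveletFamily φ ψ b x = if a = b then 1 else 0
  complete : ∀ u : ℝ → ℝ, MemLp u 2 volume →
    (∀ a : ℤ ⊕ (ℕ × ℤ), ∫ x, u x * waveletFamily φ ψ a x = 0) → u =ᵐ[volume] 0

/-- `ψ` has (at least) `n` vanishing moments. -/
def HasVanishingMoments (ψ : ℝ → ℝ) (n : ℕ) : Prop :=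
  ∀ l < n, ∫ x, x ^ l * ψ x = 0

/-- The periodized wavelet `ψ_{j,k}`, `k = 0, …, 2^j - 1`, on `[0,1]`
(a locally finite sum when `ψ` has compact support). -/
def periodized (ψ : ℝ → ℝ) (j : ℕ) (k : Fin (2 ^ j)) (t : ℝ) : ℝ :=
  ∑' l : ℤ, dyadic ψ j ((k : ℕ) : ℤ) (t + l)

/-- The wavelet coefficient `∫₀¹ f ψ_{j,k}`. -/
def waveletCoeff (ψ f : ℝ → ℝ) (j : ℕ) (k : Fin (2 ^ j)) : ℝ :=
  ∫ t in Set.Icc (0 : ℝ) 1, f t * periodized ψ j k t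

/-- The Besov sequence norm
`(∑_j 2^{j s* q} (∑_k |β_{j,k}|^p)^{q/p})^{1/q}` with `s* = s + 1/2 - 1/p` of the wavelet
coefficients of `f`, with suprema for `p = ∞` or `q = ∞`. -/
def besovNorm (ψ : ℝ → ℝ) (s : ℝ) (p q : ℝ≥0∞) (f : ℝ → ℝ) : ℝ≥0∞ :=
  eLpNorm (fun j : ℕ => (2 : ℝ) ^ ((j : ℝ) * (s + 1 / 2 - 1 / p.toReal)) *
    (eLpNorm (fun k : Fin (2 ^ j) => waveletCoeff ψ f j k) p Measure.count).toReal)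
    q Measure.count

/-! ### Additive regression functions -/

/-- A bivariate additive function `U(t, x) = mean + f t + g x`. -/
structure AdditiveFn where
  mean : ℝ
  f : ℝ → ℝ
  g : ℝ → ℝ

/-- The function `U`. -/
def AdditiveFn.eval (θ : AdditiveFn) (z : ℝ × ℝ) : ℝ :=
  θ.mean + θ.f z.1 + θ.g z.2

/-- The conditions on one univariate component: square integrable on `[0,1]`, bounded above
by `M`, with zero integral, in the Besov ball of radius `A`. -/
structure IsComponent (ψ : ℝ → ℝ) (s : ℝ) (p q : ℝ≥0∞) (A M : ℝ) (f : ℝ → ℝ) : Prop where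
  measurable : Measurable f
  memLp : MemLp f 2 (volume.restrict (Set.Icc (0 : ℝ) 1))
  le_bound : ∀ t ∈ Set.Icc (0 : ℝ) 1, f t ≤ M
  integral_eq_zero : ∫ t in Set.Icc (0 : ℝ) 1, f t = 0
  besov_le : besovNorm ψ s p q f ≤ ENNReal.ofReal A

/-- The additive functions with nonzero overall mean whose components lie in Besov balls;
`ψ₁` and `ψ₂` are the wavelets used for the first and for the second component. -/
def besovClass (ψ₁ ψ₂ : ℝ → ℝ) (s₁ s₂ : ℝ) (p q : ℝ≥0∞) (A₁ A₂ M₁ M₂ : ℝ) :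
    Set AdditiveFn :=
  {θ | θ.mean ≠ 0 ∧ IsComponent ψ₁ s₁ p q A₁ M₁ θ.f ∧ IsComponent ψ₂ s₂ p q A₂ M₂ θ.g}

/-! ### Long-memory Gaussian noise and random design -/

/-- The coefficients of a causal linear process with long-memory parameter `α`. -/
structure IsLongMemoryFilter (α : ℝ) (a : ℕ → ℝ) : Prop where
  pos : 0 < α
  lt_one : α < 1
  zero_eq_one : a 0 = 1
  tendsto : Tendsto (fun m : ℕ => a m * (m : ℝ) ^ ((α + 1) / 2)) atTop (𝓝 1)

/-- The autocovariance at lag `k` of `∑ₘ a_m η_{i-m}` with uncorrelated innovations `η`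
of variance `v`. -/
def linearAutocov (a : ℕ → ℝ) (v : ℝ≥0) (k : ℕ) : ℝ :=
  v * ∑' m : ℕ, a m * a (m + k)

/-- `d` is the spectral density of a real stationary sequence with autocovariances `γ`. -/
structure IsSpectralDensity (γ : ℕ → ℝ) (d : ℝ → ℝ) : Prop where
  nonneg : ∀ u, 0 ≤ d u
  even : ∀ u, d (-u) = d u
  integrable : IntegrableOn d (Set.Icc (-Real.pi) Real.pi)
  autocov_eq : ∀ k : ℕ, γ k = ∫ u in Set.Icc (-Real.pi) Real.pi, Real.cos (k * u) * d u

/-- The random elements of the regression model: design points `T i`, `X i` with densities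
`h₁`, `h₂` on `[0,1]`, and errors `ε i = ∑ₘ a_m η_{i-m}` (convergence in `L²`) driven by i.i.d.
centred Gaussian innovations `η`, with `Var(ε_0 + … + ε_{N-1}) ~ κ N^{2-α}`. -/
structure IsLongMemoryModel {Ω : Type*} [MeasurableSpace Ω] (P : Measure Ω)
    (T X : ℕ → Ω → ℝ) (η : ℤ → Ω → ℝ) (ε : ℕ → Ω → ℝ)
    (h₁ h₂ : ℝ → ℝ) (α : ℝ) (a : ℕ → ℝ) (v : ℝ≥0) (κ : ℝ) : Prop where
  measurable_T : ∀ i, Measurable (T i)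
  measurable_X : ∀ i, Measurable (X i)
  measurable_η : ∀ k, Measurable (η k)
  measurable_ε : ∀ i, Measurable (ε i)
  law_T : ∀ i, P.map (T i) =
    (volume.restrict (Set.Icc (0 : ℝ) 1)).withDensity fun t => ENNReal.ofReal (h₁ t)
  law_X : ∀ i, P.map (X i) =
    (volume.restrict (Set.Icc (0 : ℝ) 1)).withDensity fun x => ENNReal.ofReal (h₂ x)
  law_η : ∀ k, P.map (η k) = gaussianReal 0 v
  indep_T : iIndepFun T P
  indep_X : iIndepFun X P
  indep_η : iIndepFun η P
  indep_T_X : IndepFun (fun ω i => T i ω) (fun ω i => X i ω) P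
  indep_design_noise :
    IndepFun (fun ω => ((fun i => T i ω), (fun i => X i ω))) (fun ω k => η k ω) P
  linear : ∀ i : ℕ, Tendsto
    (fun n : ℕ => eLpNorm
      (fun ω => ε i ω - ∑ m ∈ Finset.range n, a m * η ((i : ℤ) - (m : ℤ)) ω) 2 P)
    atTop (𝓝 0)
  variance_pos : 0 < κ
  variance_sum : Tendsto
    (fun N : ℕ => variance (fun ω => ∑ i ∈ Finset.range N, ε i ω) P / (N : ℝ) ^ (2 - α))
    atTop (𝓝 κ)

/-! ### Minimax risk -/

/-- The `N` observations `(t_i, x_i, y_i)` with `y_i = U(t_i, x_i) + σ ε_i`. -/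
def observations {Ω : Type*} (T X ε : ℕ → Ω → ℝ) (σ : ℝ) (θ : AdditiveFn) (N : ℕ) (ω : Ω) :
    Fin N → ℝ × ℝ × ℝ :=
  fun i => (T i ω, X i ω, θ.eval (T i ω, X i ω) + σ * ε i ω)

/-- The `L²([0,1]²)`-risk `E ‖Û - U‖²` of the estimator `Û` based on `N` observations. -/
def risk {Ω : Type*} [MeasurableSpace Ω] (P : Measure Ω) (T X ε : ℕ → Ω → ℝ) (σ : ℝ) (N : ℕ)
    (est : (Fin N → ℝ × ℝ × ℝ) → ℝ × ℝ → ℝ) (θ : AdditiveFn) : ℝ≥0∞ :=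
  ∫⁻ ω, (∫⁻ z in Set.Icc (0 : ℝ) 1 ×ˢ Set.Icc (0 : ℝ) 1,
    ENNReal.ofReal ((est (observations T X ε σ θ N ω) z - θ.eval z) ^ 2)) ∂P

/-- The minimax risk over `Θ`: infimum over all (jointly measurable) estimators of the maximal
risk over `Θ`. -/
def additiveMinimaxRisk {Ω : Type*} [MeasurableSpace Ω] (P : Measure Ω) (T X ε : ℕ → Ω → ℝ) (σ : ℝ)
    (N : ℕ) (Θ : Set AdditiveFn) : ℝ≥0∞ :=
  ⨅ (est : (Fin N → ℝ × ℝ × ℝ) → ℝ × ℝ → ℝ) (_ : Measurable (Function.uncurry est)),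
    ⨆ θ ∈ Θ, risk P T X ε σ N est θ

/-- The rate `A² (1 / (A² N))^{2s/(2s+1)}`. -/
def besovRate (A s : ℝ) (N : ℕ) : ℝ :=
  A ^ 2 * (1 / (A ^ 2 * N)) ^ (2 * s / (2 * s + 1))

end

/-! The lower bound comes from Assouad's method applied to finite subfamilies of the class, of the
form `β + ∑ k, ±γ Ψ k` with `Ψ k` orthonormal on the unit square. By Bessel's inequality the loss
dominates the sum of the squared errors of the coordinates. The problem thus reduces to testing, for
each `k`, between two functions that differ by `2γ Ψ k`
(`IsLongMemoryModel.le_additiveMinimaxRisk`).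

Given the design, the errors form a centred Gaussian vector with Toeplitz covariance `S`, and the
two hypotheses differ by a translation `h = 2γ Ψ k / σ` evaluated at the design points. By
Cameron–Martin they cannot be told apart when the energy `h ⬝ S⁻¹ h`, averaged over the design, is
small (`HasGaussianCharFun.two_point`, `IsLongMemoryModel.two_point`).

The pole of the spectral density controls this energy in two ways
(`IsSpectralDensity.quadratic_lower_bounds`). The density is bounded below on `[-π, π]`, so the
energy is at most `K |h|²`, as for independent errors. For a constant vector `h = δ`, Cauchy–Schwarz
weighted by the pole gives the much smaller bound `K N^α δ²`.

Two choices of `Ψ` then yield the two rates. With the periodized wavelets of one component at a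
level where `2^j ≈ (A²N)^{1/(2s+1)}`, one may take `γ² ≈ 1/N`, which gives `2^j / N`, the Besov rate
(`IsLongMemoryModel.eventually_besovRate_le`). With the single function `Ψ = 1` one may take `γ² ≈
N^{-α}` (`IsLongMemoryModel.eventually_rpow_neg_le`). Both components give valid bounds whichever of
`s₁`, `s₂` is larger. -/

/-- `μ` has the characteristic function of the centred Gaussian vector with covariance `S`. -/
def HasGaussianCharFun {ι : Type*} [Fintype ι] (μ : Measure (ι → ℝ)) (S : Matrix ι ι ℝ) : Prop :=
  ∀ w : ι → ℝ, ∫ x, Complex.exp ((w ⬝ᵥ x : ℝ) * Complex.I) ∂μ =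
    Complex.exp (-((w ⬝ᵥ S.mulVec w : ℝ) : ℂ) / 2)

/-! ### Gaussian vectors: Cameron–Martin formula and two-point testing bound -/

section GaussianShift

variable {ι : Type*} [Fintype ι]

lemma measurable_dotProduct_left (w : ι → ℝ) : Measurable fun x : ι → ℝ => w ⬝ᵥ x := by
  unfold dotProduct
  fun_prop

lemma strongDual_pi_eq_dotProduct (L : StrongDual ℝ (ι → ℝ)) :
    ∃ w : ι → ℝ, ∀ x, L x = w ⬝ᵥ x := by
  classical
  refine ⟨fun i => L (Pi.single i 1), fun x => ?_⟩
  conv_lhs => rw [pi_eq_sum_univ' x]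
  simp [dotProduct, mul_comm]

lemma measure_pi_ext_of_charFun {μ ν : Measure (ι → ℝ)} [IsFiniteMeasure μ] [IsFiniteMeasure ν]
    (h : ∀ w : ι → ℝ, ∫ x, Complex.exp ((w ⬝ᵥ x : ℝ) * Complex.I) ∂μ =
      ∫ x, Complex.exp ((w ⬝ᵥ x : ℝ) * Complex.I) ∂ν) : μ = ν := by
  refine Measure.ext_of_charFunDual ?_
  ext L
  obtain ⟨w, hw⟩ := strongDual_pi_eq_dotProduct L
  simpa only [charFunDual_apply, hw] using h w

lemma HasGaussianCharFun.map_dotProduct {μ : Measure (ι → ℝ)} [IsProbabilityMeasure μ]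
    {S : Matrix ι ι ℝ} (hμ : HasGaussianCharFun μ S) (u : ι → ℝ) (Q : ℝ≥0)
    (hQ : u ⬝ᵥ S.mulVec u = Q) : μ.map (fun x => u ⬝ᵥ x) = gaussianReal 0 Q := by
  have hm := measurable_dotProduct_left u
  have : IsProbabilityMeasure (μ.map fun x => u ⬝ᵥ x) :=
    Measure.isProbabilityMeasure_map hm.aemeasurable
  refine Measure.ext_of_charFun ?_
  ext t
  rw [charFun_gaussianReal, charFun_apply_real, integral_map hm.aemeasurable (by fun_prop)]
  have := hμ (t • u)
  simp only [smul_dotProduct, Matrix.mulVec_smul, dotProduct_smul, smul_eq_mul, hQ] at this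
  push_cast at this
  rw [this]
  congr 1
  push_cast
  ring

/-- The component of a Gaussian vector along `S u` is governed by the scalar `u ⬝ x`, and the
residual is uncorrelated with that scalar. The scalar can therefore be resampled independently. This
reduces Cameron–Martin to one dimension without a density on `ι → ℝ`. -/
lemma HasGaussianCharFun.map_decomposition {μ : Measure (ι → ℝ)} [IsProbabilityMeasure μ]
    {S : Matrix ι ι ℝ} (hS : S.IsSymm) (hμ : HasGaussianCharFun μ S) (u : ι → ℝ) (Q : ℝ≥0)
    (hQ : u ⬝ᵥ S.mulVec u = Q) (hQ0 : Q ≠ 0) :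
    ((gaussianReal 0 Q).prod μ).map
      (fun z : ℝ × (ι → ℝ) =>
        (z.1 / Q) • S.mulVec u + (z.2 - ((u ⬝ᵥ z.2) / Q) • S.mulVec u)) = μ := by
  have hmu := measurable_dotProduct_left u
  have hm : Measurable (fun z : ℝ × (ι → ℝ) =>
      (z.1 / Q) • S.mulVec u + (z.2 - ((u ⬝ᵥ z.2) / Q) • S.mulVec u)) := by
    refine Measurable.add (by fun_prop) (measurable_snd.sub ?_)
    exact ((hmu.comp measurable_snd).div_const _).smul_const _
  have := Measure.isProbabilityMeasure_map (μ := (gaussianReal 0 Q).prod μ) hm.aemeasurable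
  refine measure_pi_ext_of_charFun fun w => ?_
  have hmw := measurable_dotProduct_left w
  rw [integral_map hm.aemeasurable
    (by fun_prop (disch := exact hmw) : Measurable fun x : ι → ℝ =>
      Complex.exp ((w ⬝ᵥ x : ℝ) * Complex.I)).aestronglyMeasurable]
  set h := S.mulVec u with hh
  have hQr : (Q : ℝ) ≠ 0 := by exact_mod_cast hQ0
  have hsplit : ∀ z : ℝ × (ι → ℝ),
      Complex.exp ((w ⬝ᵥ ((z.1 / Q) • h + (z.2 - ((u ⬝ᵥ z.2) / Q) • h)) : ℝ) * Complex.I) =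
      Complex.exp (((w ⬝ᵥ h / Q : ℝ) : ℂ) * z.1 * Complex.I) *
        Complex.exp (((w - (w ⬝ᵥ h / Q) • u) ⬝ᵥ z.2 : ℝ) * Complex.I) := by
    intro z
    rw [← Complex.exp_add]
    congr 1
    simp only [dotProduct_add, dotProduct_sub, dotProduct_smul, sub_dotProduct, smul_dotProduct,
      smul_eq_mul]
    push_cast
    ring
  simp_rw [hsplit]
  rw [integral_prod_mul (fun s : ℝ => Complex.exp (((w ⬝ᵥ h / Q : ℝ) : ℂ) * s * Complex.I))
    (fun x : ι → ℝ => Complex.exp (((w - (w ⬝ᵥ h / Q) • u) ⬝ᵥ x : ℝ) * Complex.I)),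
    ← charFun_apply_real, charFun_gaussianReal, hμ, hμ, ← Complex.exp_add]
  congr 1
  have hsymm : u ⬝ᵥ S.mulVec w = w ⬝ᵥ h := by
    rw [hh, Matrix.dotProduct_mulVec, ← Matrix.mulVec_transpose, hS.eq, dotProduct_comm]
  simp only [Matrix.mulVec_sub, Matrix.mulVec_smul, ← hh, dotProduct_sub, sub_dotProduct,
    smul_dotProduct, dotProduct_smul, smul_eq_mul, hsymm, hQ]
  push_cast
  have : (Q : ℂ) ≠ 0 := by exact_mod_cast hQ0
  field_simp
  ring

/-- One-dimensional Cameron–Martin: translating by exactly the variance makes the likelihood ratio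
`exp (s - Q / 2)`. -/
lemma lintegral_gaussianReal_shift {Q : ℝ≥0} (hQ : Q ≠ 0) {F : ℝ → ℝ≥0∞} (hF : Measurable F) :
    ∫⁻ s, F (s + Q) ∂(gaussianReal 0 Q) =
      ∫⁻ s, F s * ENNReal.ofReal (Real.exp (s - Q / 2)) ∂(gaussianReal 0 Q) := by
  have hG : Measurable fun s : ℝ => F s * ENNReal.ofReal (Real.exp (s - Q / 2)) :=
    hF.mul (by fun_prop)
  have h1 : ∫⁻ s, F (s + Q) ∂(gaussianReal 0 Q) = ∫⁻ s, F s ∂(gaussianReal Q Q) := by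
    rw [← zero_add (Q : ℝ), ← gaussianReal_map_add_const (Q : ℝ), lintegral_map hF (by fun_prop)]
    simp
  rw [h1, gaussianReal_of_var_ne_zero _ hQ, gaussianReal_of_var_ne_zero _ hQ,
    lintegral_withDensity_eq_lintegral_mul _ (measurable_gaussianPDF _ _) hF,
    lintegral_withDensity_eq_lintegral_mul _ (measurable_gaussianPDF _ _) hG]
  refine lintegral_congr fun s => ?_
  have : gaussianPDF Q Q s = gaussianPDF 0 Q s * ENNReal.ofReal (Real.exp (s - Q / 2)) := by
    rw [gaussianPDF, gaussianPDF, ← ENNReal.ofReal_mul (gaussianPDFReal_nonneg _ _ _)]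
    congr 1
    rw [gaussianPDFReal, gaussianPDFReal, mul_assoc (_⁻¹), ← Real.exp_add]
    congr 2
    have : (Q : ℝ) ≠ 0 := by exact_mod_cast hQ
    field_simp
    ring
  simp only [Pi.mul_apply, this]
  ring

/-- Cameron–Martin formula for a Gaussian vector. -/
lemma HasGaussianCharFun.lintegral_shift {μ : Measure (ι → ℝ)} [IsProbabilityMeasure μ]
    {S : Matrix ι ι ℝ} (hS : S.IsSymm) (hμ : HasGaussianCharFun μ S) (u : ι → ℝ) (Q : ℝ≥0)
    (hQ : u ⬝ᵥ S.mulVec u = Q) (hQ0 : Q ≠ 0) {F : (ι → ℝ) → ℝ≥0∞} (hF : Measurable F) :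
    ∫⁻ x, F (x + S.mulVec u) ∂μ =
      ∫⁻ x, F x * ENNReal.ofReal (Real.exp (u ⬝ᵥ x - Q / 2)) ∂μ := by
  have hmu := measurable_dotProduct_left u
  have hQr : (Q : ℝ) ≠ 0 := by exact_mod_cast hQ0
  have hm : Measurable (fun z : ℝ × (ι → ℝ) =>
      (z.1 / Q) • S.mulVec u + (z.2 - ((u ⬝ᵥ z.2) / Q) • S.mulVec u)) := by
    refine Measurable.add (by fun_prop) (measurable_snd.sub ?_)
    exact ((hmu.comp measurable_snd).div_const _).smul_const _
  have hdec := hμ.map_decomposition hS u Q hQ hQ0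
  have hG : Measurable fun x => F x * ENNReal.ofReal (Real.exp (u ⬝ᵥ x - Q / 2)) :=
    hF.mul (by fun_prop)
  have hF' : Measurable fun x => F (x + S.mulVec u) := hF.comp (by fun_prop)
  conv_lhs => rw [← hdec]
  conv_rhs => rw [← hdec]
  rw [lintegral_map hF' hm, lintegral_map hG hm]
  refine (lintegral_prod_symm _ (hF'.comp hm).aemeasurable).trans
    (Eq.trans ?_ (lintegral_prod_symm _ (hG.comp hm).aemeasurable).symm)
  refine lintegral_congr fun x => ?_
  simp only [Function.comp_apply]
  -- The residual is annihilated by `u`, so the translation by `S u` moves only the scalar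
  -- coordinate, by `Q`.
  set r := x - ((u ⬝ᵥ x) / Q) • S.mulVec u with hr
  have hur : u ⬝ᵥ r = 0 := by
    rw [hr, dotProduct_sub, dotProduct_smul, hQ, smul_eq_mul]
    field_simp
    ring
  have := lintegral_gaussianReal_shift hQ0 (F := fun s => F ((s / Q) • S.mulVec u + r))
    (hF.comp (by fun_prop))
  convert this using 1
  · refine lintegral_congr fun s => ?_
    congr 1
    rw [add_div, div_self hQr, add_smul, one_smul]
    abel
  · refine lintegral_congr fun s => ?_
    rw [dotProduct_add, hur, dotProduct_smul, hQ, smul_eq_mul, div_mul_cancel₀ _ hQr, add_zero]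

lemma HasGaussianCharFun.lintegral_sq {μ : Measure (ι → ℝ)} [IsProbabilityMeasure μ]
    {S : Matrix ι ι ℝ} (hμ : HasGaussianCharFun μ S) (u : ι → ℝ) (Q : ℝ≥0)
    (hQ : u ⬝ᵥ S.mulVec u = Q) : ∫⁻ x, ENNReal.ofReal ((u ⬝ᵥ x) ^ 2) ∂μ = Q := by
  have h1 := lintegral_map (μ := μ) (f := fun y : ℝ => ENNReal.ofReal (y ^ 2)) (by fun_prop)
    (measurable_dotProduct_left u)
  rw [← h1, hμ.map_dotProduct u Q hQ, ← ofReal_integral_eq_lintegral_ofReal]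
  · have : Var[fun x : ℝ => x; gaussianReal 0 Q] = Q := variance_fun_id_gaussianReal
    rw [variance_of_integral_eq_zero (by fun_prop) (by simp)] at this
    rw [this]
    simp
  · exact (memLp_id_gaussianReal' 2 (by simp)).integrable_sq
  · exact Eventually.of_forall fun x => sq_nonneg x

/-- Two-point lower bound for testing between a centred Gaussian vector and its translate. -/
lemma HasGaussianCharFun.two_point {μ : Measure (ι → ℝ)} [IsProbabilityMeasure μ]
    {S : Matrix ι ι ℝ} (hS : S.IsSymm) (hμ : HasGaussianCharFun μ S) (u : ι → ℝ)
    (hQ0 : S.mulVec u = 0 ∨ 0 < u ⬝ᵥ S.mulVec u) {F G : (ι → ℝ) → ℝ≥0∞} (hF : Measurable F)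
    (hG : Measurable G) (D : ℝ≥0∞) (hD : ∀ x, D ≤ F x + G x) :
    D * ENNReal.ofReal (3 / 4) ≤ ∫⁻ x, F x ∂μ + ∫⁻ x, G (x + S.mulVec u) ∂μ +
      D * ENNReal.ofReal (3 / 2 * (u ⬝ᵥ S.mulVec u)) := by
  -- If `S u = 0` there is no translation and `D ≤ F + G` is integrated directly.
  rcases hQ0 with h0 | hpos
  · simp only [h0, add_zero, dotProduct_zero, mul_zero, ENNReal.ofReal_zero]
    rw [← lintegral_add_left hF]
    calc D * ENNReal.ofReal (3 / 4) ≤ D * 1 := by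
          gcongr
          rw [← ENNReal.ofReal_one]
          exact ENNReal.ofReal_le_ofReal (by norm_num)
      _ = ∫⁻ _, D ∂μ := by simp
      _ ≤ _ := lintegral_mono hD
  · set Q : ℝ≥0 := ⟨u ⬝ᵥ S.mulVec u, hpos.le⟩ with hQdef
    have hQ : u ⬝ᵥ S.mulVec u = Q := rfl
    have hQne : Q ≠ 0 := by
      intro h
      rw [hQ, h] at hpos
      simp at hpos
    rw [hμ.lintegral_shift hS u Q hQ hQne hG, hQ]
    have hmu := measurable_dotProduct_left u
    have hsq := hμ.lintegral_sq u Q hQ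
    have key : ∀ x : ι → ℝ, D * ENNReal.ofReal (3 / 4) ≤
        (F x + G x * ENNReal.ofReal (Real.exp (u ⬝ᵥ x - Q / 2))) +
          D * (ENNReal.ofReal ((u ⬝ᵥ x) ^ 2) + ENNReal.ofReal (Q / 2)) := by
      intro x
      set y := u ⬝ᵥ x
      set m := min 1 (Real.exp (y - Q / 2)) with hmdef
      have hm0 : 0 ≤ m := le_min zero_le_one (Real.exp_pos _).le
      -- From `1 + t ≤ exp t` with `t = y - Q / 2`, the right side is at least `y² + y + 1 = (y +
      -- 1/2)² + 3/4`. Integrating `y² + Q / 2` gives the error term `3/2 * Q`.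
      have hm : 3 / 4 ≤ m + (y ^ 2 + Q / 2) := by
        have hQ' : (0 : ℝ) ≤ Q := Q.2
        rcases min_choice 1 (Real.exp (y - Q / 2)) with h | h
        · rw [hmdef, h]
          nlinarith [sq_nonneg y]
        · rw [hmdef, h]
          nlinarith [Real.add_one_le_exp (y - Q / 2), sq_nonneg (y + 1 / 2)]
      calc D * ENNReal.ofReal (3 / 4) ≤ D * ENNReal.ofReal (m + (y ^ 2 + Q / 2)) := by gcongr
        _ = D * ENNReal.ofReal m + D * (ENNReal.ofReal (y ^ 2) + ENNReal.ofReal (Q / 2)) := by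
            rw [ENNReal.ofReal_add hm0 (by positivity), ENNReal.ofReal_add (by positivity)
              (by positivity), mul_add]
        _ ≤ _ := by
            gcongr
            calc D * ENNReal.ofReal m ≤ (F x + G x) * ENNReal.ofReal m := by
                  gcongr
                  exact hD x
              _ ≤ F x * 1 + G x * ENNReal.ofReal (Real.exp (y - Q / 2)) := by
                  rw [add_mul]
                  gcongr
                  · rw [← ENNReal.ofReal_one]
                    exact ENNReal.ofReal_le_ofReal (min_le_left _ _)
                  · exact min_le_right _ _
              _ = _ := by rw [mul_one]
    calc D * ENNReal.ofReal (3 / 4) = ∫⁻ _, D * ENNReal.ofReal (3 / 4) ∂μ := by simp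
      _ ≤ _ := lintegral_mono key
      _ = _ := by
        have hGL : Measurable fun x => G x * ENNReal.ofReal (Real.exp (u ⬝ᵥ x - Q / 2)) :=
          hG.mul (by fun_prop)
        rw [lintegral_add_left (hF.fun_add hGL), lintegral_add_left hF,
          lintegral_const_mul _ (by fun_prop), lintegral_add_left (by fun_prop), hsq]
        congr 2
        simp only [lintegral_const, measure_univ, mul_one]
        rw [← ENNReal.ofReal_coe_nnreal, ← ENNReal.ofReal_add (by positivity) (by positivity)]
        congr 1
        ring

end GaussianShift

/-! ### Toeplitz covariance matrices and the spectral density -/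

/-- The covariance matrix of `N` consecutive terms of a stationary sequence. -/
def toeplitz (γ : ℕ → ℝ) (N : ℕ) : Matrix (Fin N) (Fin N) ℝ :=
  Matrix.of fun i j => γ ((i : ℤ) - (j : ℤ)).natAbs

lemma toeplitz_isSymm (γ : ℕ → ℝ) (N : ℕ) : (toeplitz γ N).IsSymm := by
  ext i j
  simp [toeplitz, ← Int.natAbs_neg ((i : ℤ) - (j : ℤ))]

section Spectral

/-- The cosine polynomial with coefficients `w`. -/
noncomputable def cosPoly {N : ℕ} (w : Fin N → ℝ) (u : ℝ) : ℝ := ∑ j, w j * Real.cos (j * u)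

/-- The sine polynomial with coefficients `w`. -/
noncomputable def sinPoly {N : ℕ} (w : Fin N → ℝ) (u : ℝ) : ℝ := ∑ j, w j * Real.sin (j * u)

@[fun_prop]
lemma continuous_cosPoly {N : ℕ} (w : Fin N → ℝ) : Continuous (cosPoly w) := by
  unfold cosPoly
  fun_prop

@[fun_prop]
lemma continuous_sinPoly {N : ℕ} (w : Fin N → ℝ) : Continuous (sinPoly w) := by
  unfold sinPoly
  fun_prop

/-- The left side is the real part of `p(w) * conj p(z)` for the trigonometric polynomials with
coefficients `w` and `z`. Keeping cosine and sine apart avoids complex integrals. -/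
lemma cos_mul_add_sin_mul {N : ℕ} (w z : Fin N → ℝ) (u : ℝ) :
    cosPoly w u * cosPoly z u + sinPoly w u * sinPoly z u =
      ∑ i, ∑ j, w i * z j * Real.cos (((i : ℤ) - (j : ℤ)).natAbs * u) := by
  simp only [cosPoly, sinPoly, Finset.sum_mul_sum, ← Finset.sum_add_distrib]
  refine Finset.sum_congr rfl fun i _ => Finset.sum_congr rfl fun j _ => ?_
  have : Real.cos (((i : ℤ) - (j : ℤ)).natAbs * u) = Real.cos (i * u - j * u) := by
    rw [Nat.cast_natAbs, Int.cast_abs, ← sub_mul]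
    push_cast
    rcases abs_choice ((i : ℝ) - (j : ℝ)) with h | h
    · rw [h]
    · rw [h, neg_mul, Real.cos_neg]
  rw [this, Real.cos_sub]
  ring

lemma integrableOn_mul_of_continuous {d g : ℝ → ℝ} {a b : ℝ}
    (hd : IntegrableOn d (Set.Icc a b)) (hg : Continuous g) :
    IntegrableOn (fun u => g u * d u) (Set.Icc a b) := by
  simpa only [mul_comm] using hd.mul_continuousOn hg.continuousOn isCompact_Icc

lemma IsSpectralDensity.bilinear {γ : ℕ → ℝ} {d : ℝ → ℝ} (h : IsSpectralDensity γ d) {N : ℕ}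
    (w z : Fin N → ℝ) :
    w ⬝ᵥ (toeplitz γ N).mulVec z = ∫ u in Set.Icc (-Real.pi) Real.pi,
      (cosPoly w u * cosPoly z u + sinPoly w u * sinPoly z u) * d u := by
  have hint : ∀ k : ℕ, IntegrableOn (fun u => Real.cos (k * u) * d u)
      (Set.Icc (-Real.pi) Real.pi) := fun k =>
    integrableOn_mul_of_continuous h.integrable (by fun_prop)
  simp_rw [cos_mul_add_sin_mul, Finset.sum_mul, mul_assoc (_ * _ : ℝ)]
  rw [integral_finsetSum _ fun i _ => integrable_finsetSum _ fun j _ => (hint _).const_mul _]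
  simp only [dotProduct, Matrix.mulVec, toeplitz, Matrix.of_apply, Finset.mul_sum]
  refine Finset.sum_congr rfl fun i _ => ?_
  rw [integral_finsetSum _ fun j _ => (hint _).const_mul _]
  refine Finset.sum_congr rfl fun j _ => ?_
  rw [integral_const_mul, ← h.autocov_eq]
  ring

/-- White noise with constant density: inserted in `IsSpectralDensity.bilinear`, it gives Parseval's
identity for trigonometric polynomials. -/
lemma isSpectralDensity_one :
    IsSpectralDensity (fun k => if k = 0 then 2 * Real.pi else 0) (fun _ => 1) where
  nonneg _ := zero_le_one
  even _ := rfl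
  integrable := by simp
  autocov_eq k := by
    simp only [mul_one]
    rw [integral_Icc_eq_integral_Ioc, ← intervalIntegral.integral_of_le (by linarith [Real.pi_pos])]
    rcases eq_or_ne k 0 with rfl | hk
    · simp
      ring
    · have hk' : (k : ℝ) ≠ 0 := by exact_mod_cast hk
      rw [intervalIntegral.integral_comp_mul_left _ hk']
      simp [hk, Real.sin_nat_mul_pi]

lemma integral_cos_mul_add_sin_mul {N : ℕ} (w z : Fin N → ℝ) :
    ∫ u in Set.Icc (-Real.pi) Real.pi, (cosPoly w u * cosPoly z u + sinPoly w u * sinPoly z u) =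
      2 * Real.pi * (w ⬝ᵥ z) := by
  have := isSpectralDensity_one.bilinear w z
  simp only [mul_one] at this
  rw [← this]
  have : toeplitz (fun k => if k = 0 then 2 * Real.pi else 0) N = (2 * Real.pi) • 1 := by
    ext i j
    simp [toeplitz, Matrix.one_apply, sub_eq_zero, Fin.ext_iff]
  rw [this, Matrix.smul_mulVec, Matrix.one_mulVec, dotProduct_smul, smul_eq_mul]

lemma dirichlet_sq_le_card (N : ℕ) (u : ℝ) :
    cosPoly (fun _ : Fin N => 1) u ^ 2 + sinPoly (fun _ : Fin N => 1) u ^ 2 ≤ (N : ℝ) ^ 2 := by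
  rw [sq, sq, cos_mul_add_sin_mul]
  calc _ ≤ ∑ _i : Fin N, ∑ _j : Fin N, (1 : ℝ) := by
        gcongr
        simpa using Real.cos_le_one _
    _ = _ := by simp [sq]

/-- The geometric sum gives `|D| * |e^{iu} - 1| = |e^{iNu} - 1| ≤ 2` for the Dirichlet kernel `D`,
and `1 - cos u ≥ 2u²/π²` on `[-π, π]`. -/
lemma dirichlet_sq_mul_sq_le (N : ℕ) {u : ℝ} (hu : |u| ≤ Real.pi) :
    (cosPoly (fun _ : Fin N => 1) u ^ 2 + sinPoly (fun _ : Fin N => 1) u ^ 2) * u ^ 2 ≤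
      Real.pi ^ 2 := by
  set X := cosPoly (fun _ : Fin N => 1) u with hX
  set Y := sinPoly (fun _ : Fin N => 1) u with hY
  set e := Complex.exp (u * Complex.I) with he
  have hpow : ∀ n : ℕ, e ^ n = Real.cos (n * u) + Real.sin (n * u) * Complex.I := by
    intro n
    rw [he, ← Complex.exp_nat_mul, ← mul_assoc, Complex.exp_mul_I]
    push_cast
    rfl
  have hgeom : ((X : ℂ) + Y * Complex.I) * (e - 1) = e ^ N - 1 := by
    rw [← geom_sum_mul]
    congr 1
    simp only [hX, hY, cosPoly, sinPoly, one_mul, hpow, ← Fin.sum_univ_eq_sum_range]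
    push_cast
    rw [Finset.sum_add_distrib, Finset.sum_mul]
  have hn : ∀ n : ℕ, Complex.normSq (e ^ n - 1) = 2 - 2 * Real.cos (n * u) := by
    intro n
    rw [hpow, Complex.normSq_apply]
    simp only [Complex.sub_re, Complex.add_re, Complex.ofReal_re, Complex.mul_re, Complex.I_re,
      mul_zero, Complex.ofReal_im, Complex.I_im, mul_one, sub_self, add_zero, Complex.one_re,
      Complex.sub_im, Complex.add_im, Complex.mul_im, zero_add, Complex.one_im, sub_zero]
    nlinarith [Real.sin_sq_add_cos_sq (n * u)]
  have h1 := congrArg Complex.normSq hgeom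
  have h2 := hn 1
  rw [pow_one, Nat.cast_one, one_mul] at h2
  rw [map_mul, h2, hn, Complex.normSq_add_mul_I] at h1
  have h3 := Real.cos_le_one_sub_mul_cos_sq hu
  have h4 := Real.neg_one_le_cos (N * u)
  have hpi := Real.pi_pos
  have h5 : (X ^ 2 + Y ^ 2) * (2 * (2 / Real.pi ^ 2 * u ^ 2)) ≤ 4 := by
    calc _ ≤ (X ^ 2 + Y ^ 2) * (2 - 2 * Real.cos u) := by
          gcongr
          linarith
      _ ≤ 4 := by rw [h1]; linarith
  have h6 : (X ^ 2 + Y ^ 2) * (2 * (2 / Real.pi ^ 2 * u ^ 2)) =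
      4 * ((X ^ 2 + Y ^ 2) * u ^ 2) / Real.pi ^ 2 := by
    field_simp
    ring
  rw [h6, div_le_iff₀ (by positivity)] at h5
  linarith

lemma integrable_comp_abs {f : ℝ → ℝ} (hf : IntegrableOn f (Set.Ioi 0)) :
    Integrable fun x => f |x| := by
  have h1 : IntegrableOn (fun x => f |x|) (Set.Ioi 0) :=
    hf.congr_fun (fun x hx => by rw [abs_of_pos (Set.mem_Ioi.1 hx)]) measurableSet_Ioi
  have h2 : IntegrableOn (fun x => f |x|) (Set.Iic 0) := by
    rw [← Measure.map_neg_eq_self (volume : Measure ℝ)]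
    have m : MeasurableEmbedding fun x : ℝ => -x := (Homeomorph.neg ℝ).measurableEmbedding
    rw [m.integrableOn_map_iff]
    simp_rw [Function.comp_def, abs_neg, Set.neg_preimage, Set.neg_Iic, neg_zero]
    exact Iff.mpr integrableOn_Ici_iff_integrableOn_Ioi h1
  rw [← integrableOn_univ, ← Set.Iic_union_Ioi (a := (0 : ℝ))]
  exact h2.union h1

/-- The weighted energy of the Dirichlet kernel. -/
lemma integral_dirichlet_sq_le {α : ℝ} (hα0 : 0 < α) (hα1 : α < 1) {N : ℕ} (hN : 0 < N) :
    ∫ u in Set.Icc (-Real.pi) Real.pi,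
      (cosPoly (fun _ : Fin N => 1) u ^ 2 + sinPoly (fun _ : Fin N => 1) u ^ 2) *
        |u| ^ (1 - α) ≤ 2 * (1 / (2 - α) + Real.pi ^ 2 / α) * (N : ℝ) ^ α := by
  have hN' : (0 : ℝ) < N := by exact_mod_cast hN
  have hinv : (0 : ℝ) < (N : ℝ)⁻¹ := by positivity
  -- An envelope: the trivial bound `N²` near the origin and the decay `π² / u²` beyond `1/N`. Each
  -- piece, weighted by `u^{1-α}`, integrates to a multiple of `N^α`.
  set g : ℝ → ℝ := fun u => if u ≤ (N : ℝ)⁻¹ then (N : ℝ) ^ 2 * u ^ (1 - α)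
    else Real.pi ^ 2 * u ^ (-1 - α) with hg
  have hbig : ∫ u in Set.Ioi (N : ℝ)⁻¹, g u = Real.pi ^ 2 / α * (N : ℝ) ^ α := by
    have : ∫ u in Set.Ioi (N : ℝ)⁻¹, g u = ∫ u in Set.Ioi (N : ℝ)⁻¹, Real.pi ^ 2 * u ^ (-1 - α) :=
      setIntegral_congr_fun measurableSet_Ioi fun u hu => if_neg (not_le.2 hu)
    rw [this, integral_const_mul, integral_Ioi_rpow_of_lt (by linarith) hinv]
    rw [show -1 - α + 1 = -α by ring, Real.inv_rpow hN'.le, ← Real.rpow_neg hN'.le, neg_neg]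
    field_simp
  have hsmall : ∫ u in Set.Ioc 0 (N : ℝ)⁻¹, g u = 1 / (2 - α) * (N : ℝ) ^ α := by
    have : ∫ u in Set.Ioc 0 (N : ℝ)⁻¹, g u = ∫ u in Set.Ioc 0 (N : ℝ)⁻¹,
        (N : ℝ) ^ 2 * u ^ (1 - α) :=
      setIntegral_congr_fun measurableSet_Ioc fun u hu => if_pos hu.2
    rw [this, ← intervalIntegral.integral_of_le hinv.le, intervalIntegral.integral_const_mul,
      integral_rpow (Or.inl (by linarith)), Real.zero_rpow (by linarith),
      show 1 - α + 1 = 2 - α by ring, Real.inv_rpow hN'.le, Real.rpow_sub hN', Real.rpow_two]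
    field_simp
    ring
  have hi1 : IntegrableOn g (Set.Ioc 0 (N : ℝ)⁻¹) := by
    refine IntegrableOn.congr_fun (f := fun u : ℝ => (N : ℝ) ^ 2 * u ^ (1 - α)) ?_
      (fun u hu => (if_pos hu.2).symm) measurableSet_Ioc
    rw [← intervalIntegrable_iff_integrableOn_Ioc_of_le hinv.le]
    exact (intervalIntegral.intervalIntegrable_rpow' (by linarith)).const_mul _
  have hi2 : IntegrableOn g (Set.Ioi (N : ℝ)⁻¹) := by
    refine IntegrableOn.congr_fun (f := fun u : ℝ => Real.pi ^ 2 * u ^ (-1 - α)) ?_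
      (fun u hu => (if_neg (not_le.2 hu)).symm) measurableSet_Ioi
    exact (integrableOn_Ioi_rpow_of_lt (by linarith) hinv).const_mul _
  have hi : IntegrableOn g (Set.Ioi 0) := by
    rw [← Set.Ioc_union_Ioi_eq_Ioi hinv.le]
    exact hi1.union hi2
  have htot : ∫ u in Set.Ioi 0, g u = (1 / (2 - α) + Real.pi ^ 2 / α) * (N : ℝ) ^ α := by
    rw [← Set.Ioc_union_Ioi_eq_Ioi hinv.le, setIntegral_union (Set.Ioc_disjoint_Ioi le_rfl)
      measurableSet_Ioi hi1 hi2, hbig, hsmall]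
    ring
  have hgnn : ∀ u, 0 ≤ u → 0 ≤ g u := by
    intro u hu
    simp only [hg]
    split_ifs <;> positivity
  have hia : Integrable fun u : ℝ => g |u| := integrable_comp_abs hi
  calc _ ≤ ∫ u in Set.Icc (-Real.pi) Real.pi, g |u| := by
        refine setIntegral_mono_on ?_ hia.integrableOn measurableSet_Icc fun u hu => ?_
        · refine ContinuousOn.integrableOn_compact isCompact_Icc (Continuous.continuousOn ?_)
          exact (((continuous_cosPoly _).pow 2).add ((continuous_sinPoly _).pow 2)).mul
            (continuous_abs.rpow_const fun _ => Or.inr (by linarith))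
        · simp only [hg]
          split_ifs with h
          · gcongr
            exact dirichlet_sq_le_card N u
          · have hu0 : 0 < |u| := hinv.trans (not_le.1 h)
            have := dirichlet_sq_mul_sq_le N (abs_le.2 hu)
            have hpow : |u| ^ (1 - α) = u ^ 2 * |u| ^ (-1 - α) := by
              rw [← sq_abs, ← Real.rpow_two, ← Real.rpow_add hu0]
              ring_nf
            rw [hpow, ← mul_assoc]
            gcongr
    _ ≤ ∫ u, g |u| :=
        setIntegral_le_integral hia (Eventually.of_forall fun u => hgnn _ (abs_nonneg u))
    _ = _ := by rw [integral_comp_abs, htot]; ring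

/-- A spectral density with a pole of order `1 - α` at the origin gives lower bounds for the
covariance quadratic form. -/
lemma IsSpectralDensity.quadratic_lower_bounds {γ : ℕ → ℝ} {d : ℝ → ℝ}
    (h : IsSpectralDensity γ d) {α c : ℝ} (hα0 : 0 < α) (hα1 : α < 1) (hc : 0 < c)
    (hd : ∀ᵐ u ∂(volume.restrict (Set.Icc (-Real.pi) Real.pi)), c * |u| ^ (α - 1) ≤ d u) :
    ∃ K : ℝ, 0 < K ∧ ∀ N : ℕ, ∀ w : Fin N → ℝ,
      w ⬝ᵥ w ≤ K * (w ⬝ᵥ (toeplitz γ N).mulVec w) ∧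
      (∑ i, w i) ^ 2 ≤ K * (N : ℝ) ^ α * (w ⬝ᵥ (toeplitz γ N).mulVec w) := by
  have hpi := Real.pi_pos
  have hne : ∀ᵐ u : ℝ ∂(volume.restrict (Set.Icc (-Real.pi) Real.pi)), u ≠ 0 :=
    ae_restrict_of_ae (by simp [ae_iff])
  have hmem : ∀ᵐ u : ℝ ∂(volume.restrict (Set.Icc (-Real.pi) Real.pi)),
      u ∈ Set.Icc (-Real.pi) Real.pi := ae_restrict_mem measurableSet_Icc
  -- Since `α < 1`, the pole is smallest at the endpoints `±π`; the factor `2π` comes from Parseval.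
  set b := c * Real.pi ^ (α - 1) * (2 * Real.pi) with hb
  have hb0 : 0 < b := by positivity
  set J := 2 * (1 / (2 - α) + Real.pi ^ 2 / α) with hJ
  have hJ0 : 0 < J := by
    have : 0 < 2 - α := by linarith
    positivity
  have hQ1 : ∀ N : ℕ, ∀ w : Fin N → ℝ, b * (w ⬝ᵥ w) ≤ w ⬝ᵥ (toeplitz γ N).mulVec w := by
    intro N w
    rw [h.bilinear, hb, mul_assoc, ← integral_cos_mul_add_sin_mul, ← integral_const_mul]
    have hcont : Continuous fun u =>
        cosPoly w u * cosPoly w u + sinPoly w u * sinPoly w u := by fun_prop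
    refine setIntegral_mono_ae_restrict
      ((hcont.const_mul _).continuousOn.integrableOn_compact isCompact_Icc)
      (integrableOn_mul_of_continuous h.integrable hcont) ?_
    filter_upwards [hd, hne, hmem] with u h1 h2 h3
    rw [mul_comm]
    have : Real.pi ^ (α - 1) ≤ |u| ^ (α - 1) :=
      Real.rpow_le_rpow_of_nonpos (abs_pos.2 h2) (abs_le.2 h3) (by linarith)
    have : c * Real.pi ^ (α - 1) ≤ d u := le_trans (by gcongr) h1
    have h0 : 0 ≤ cosPoly w u * cosPoly w u + sinPoly w u * sinPoly w u :=
      add_nonneg (mul_self_nonneg _) (mul_self_nonneg _)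
    exact mul_le_mul_of_nonneg_left this h0
  have hQ2 : ∀ N : ℕ, 0 < N → ∀ w : Fin N → ℝ, (2 * Real.pi * ∑ i, w i) ^ 2 ≤
      J / c * (N : ℝ) ^ α * (w ⬝ᵥ (toeplitz γ N).mulVec w) := by
    intro N hN w
    set Q := w ⬝ᵥ (toeplitz γ N).mulVec w with hQ
    set o : Fin N → ℝ := fun _ => 1
    have hsum : ∑ i, w i = w ⬝ᵥ o := by simp [dotProduct, o]
    have hcw : Continuous fun u =>
        cosPoly w u * cosPoly w u + sinPoly w u * sinPoly w u := by fun_prop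
    have hcwo : Continuous fun u =>
        cosPoly w u * cosPoly o u + sinPoly w u * sinPoly o u := by fun_prop
    have hco : Continuous fun u : ℝ => (cosPoly o u ^ 2 + sinPoly o u ^ 2) * |u| ^ (1 - α) :=
      (((continuous_cosPoly _).pow 2).add ((continuous_sinPoly _).pow 2)).mul
        (continuous_abs.rpow_const fun _ => Or.inr (by linarith))
    have i1 := integrableOn_mul_of_continuous h.integrable hcw
    have i2 : IntegrableOn _ (Set.Icc (-Real.pi) Real.pi) :=
      hcwo.continuousOn.integrableOn_compact (μ := volume) isCompact_Icc
    have i3 : IntegrableOn _ (Set.Icc (-Real.pi) Real.pi) :=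
      hco.continuousOn.integrableOn_compact (μ := volume) isCompact_Icc
    -- Cauchy–Schwarz with weight `r = c |u|^{α-1}`, in discriminant form: the integral of `r⁻¹ |t r
    -- p(w) - D|²`, with `D` the Dirichlet kernel, is nonnegative for every `t`. The cross term
    -- equals `2π ∑ w i`, and the `r⁻¹` term is the weighted Dirichlet energy.
    have hdisc : ∀ t : ℝ, 0 ≤ Q * (t * t) + (-2 * (2 * Real.pi * ∑ i, w i)) * t +
        J / c * (N : ℝ) ^ α := by
      intro t
      have hnn : 0 ≤ ∫ u in Set.Icc (-Real.pi) Real.pi,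
          ((t * t) * ((cosPoly w u * cosPoly w u + sinPoly w u * sinPoly w u) * d u) -
            (2 * t) * (cosPoly w u * cosPoly o u + sinPoly w u * sinPoly o u) +
            c⁻¹ * ((cosPoly o u ^ 2 + sinPoly o u ^ 2) * |u| ^ (1 - α))) := by
        refine integral_nonneg_of_ae ?_
        filter_upwards [hd, hne] with u h1 h2
        have hu : 0 < |u| := abs_pos.2 h2
        set r := c * |u| ^ (α - 1) with hr
        have hr0 : 0 < r := by positivity
        have hrinv : c⁻¹ * |u| ^ (1 - α) = r⁻¹ := by
          rw [hr, mul_inv, ← Real.rpow_neg hu.le, neg_sub]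
        have hx : 0 ≤ cosPoly w u * cosPoly w u + sinPoly w u * sinPoly w u :=
          add_nonneg (mul_self_nonneg _) (mul_self_nonneg _)
        have e1 : c⁻¹ * ((cosPoly o u ^ 2 + sinPoly o u ^ 2) * |u| ^ (1 - α)) =
            r⁻¹ * (cosPoly o u ^ 2 + sinPoly o u ^ 2) := by rw [← hrinv]; ring
        have e2 : (t * t) * ((cosPoly w u * cosPoly w u + sinPoly w u * sinPoly w u) * r) ≤
            (t * t) * ((cosPoly w u * cosPoly w u + sinPoly w u * sinPoly w u) * d u) := by
          have := mul_self_nonneg t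
          gcongr
        have e3 : 0 ≤ r⁻¹ * ((t * r * cosPoly w u - cosPoly o u) ^ 2 +
            (t * r * sinPoly w u - sinPoly o u) ^ 2) := by positivity
        have e4 : r⁻¹ * ((t * r * cosPoly w u - cosPoly o u) ^ 2 +
            (t * r * sinPoly w u - sinPoly o u) ^ 2) =
            (t * t) * ((cosPoly w u * cosPoly w u + sinPoly w u * sinPoly w u) * r) -
            (2 * t) * (cosPoly w u * cosPoly o u + sinPoly w u * sinPoly o u) +
            r⁻¹ * (cosPoly o u ^ 2 + sinPoly o u ^ 2) := by
          field_simp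
          ring
        simp only [Pi.zero_apply]
        rw [e1]
        linarith
      have i12 : IntegrableOn (fun u =>
          (t * t) * ((cosPoly w u * cosPoly w u + sinPoly w u * sinPoly w u) * d u) -
            (2 * t) * (cosPoly w u * cosPoly o u + sinPoly w u * sinPoly o u))
          (Set.Icc (-Real.pi) Real.pi) := (i1.const_mul _).sub (i2.const_mul _)
      rw [integral_add i12 (i3.const_mul _),
        integral_sub (i1.const_mul _) (i2.const_mul _), integral_const_mul, integral_const_mul,
        integral_const_mul, integral_cos_mul_add_sin_mul, ← h.bilinear, ← hQ, ← hsum] at hnn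
      have hJN := mul_le_mul_of_nonneg_left (integral_dirichlet_sq_le hα0 hα1 hN)
        (inv_nonneg.2 hc.le)
      rw [← hJ] at hJN
      have : c⁻¹ * (J * (N : ℝ) ^ α) = J / c * (N : ℝ) ^ α := by
        field_simp
      linarith
    have := discrim_le_zero hdisc
    rw [discrim] at this
    linarith
  have hQ0 : ∀ N : ℕ, ∀ w : Fin N → ℝ, 0 ≤ w ⬝ᵥ (toeplitz γ N).mulVec w := fun N w =>
    le_trans (mul_nonneg hb0.le (Finset.sum_nonneg fun i _ => mul_self_nonneg _)) (hQ1 N w)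
  refine ⟨1 / b + J / c / (2 * Real.pi) ^ 2, by positivity, fun N w => ⟨?_, ?_⟩⟩
  · have h1 := hQ1 N w
    have h2 := hQ0 N w
    calc w ⬝ᵥ w = 1 / b * (b * (w ⬝ᵥ w)) := by field_simp
      _ ≤ 1 / b * (w ⬝ᵥ (toeplitz γ N).mulVec w) := by gcongr
      _ ≤ _ := by
        gcongr
        exact le_add_of_nonneg_right (by positivity)
  · rcases Nat.eq_zero_or_pos N with rfl | hN
    · simp
    · have h1 := hQ2 N hN w
      have h2 := hQ0 N w
      calc (∑ i, w i) ^ 2 = (2 * Real.pi * ∑ i, w i) ^ 2 / (2 * Real.pi) ^ 2 := by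
            field_simp
        _ ≤ (J / c * (N : ℝ) ^ α * (w ⬝ᵥ (toeplitz γ N).mulVec w)) / (2 * Real.pi) ^ 2 := by gcongr
        _ = J / c / (2 * Real.pi) ^ 2 * (N : ℝ) ^ α * (w ⬝ᵥ (toeplitz γ N).mulVec w) := by ring
        _ ≤ _ := by
          gcongr
          exact le_add_of_nonneg_left (by positivity)

/-- Solvability of `S u = h` together with bounds for the energy `u ⬝ S u`. -/
lemma exists_mulVec_eq_of_quadratic_lower_bounds {N : ℕ} {S : Matrix (Fin N) (Fin N) ℝ}
    {K B : ℝ} (hK : 0 < K) (hB : 0 ≤ B)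
    (h1 : ∀ w : Fin N → ℝ, w ⬝ᵥ w ≤ K * (w ⬝ᵥ S.mulVec w))
    (h2 : ∀ w : Fin N → ℝ, (∑ i, w i) ^ 2 ≤ B * (w ⬝ᵥ S.mulVec w)) (h : Fin N → ℝ) :
    ∃ u : Fin N → ℝ, S.mulVec u = h ∧ (S.mulVec u = 0 ∨ 0 < u ⬝ᵥ S.mulVec u) ∧
      u ⬝ᵥ S.mulVec u ≤ K * (h ⬝ᵥ h) ∧
      ∀ δ : ℝ, h = (fun _ => δ) → u ⬝ᵥ S.mulVec u ≤ B * δ ^ 2 := by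
  have hnn : ∀ w : Fin N → ℝ, 0 ≤ w ⬝ᵥ w := fun w => Finset.sum_nonneg fun i _ => mul_self_nonneg _
  have hpos : ∀ w : Fin N → ℝ, S.mulVec w = 0 ∨ 0 < w ⬝ᵥ S.mulVec w := by
    intro w
    rcases eq_or_ne w 0 with rfl | hw
    · simp
    · refine Or.inr (pos_of_mul_pos_right (lt_of_lt_of_le ?_ (h1 w)) hK.le)
      exact lt_of_le_of_ne (hnn w) fun h0 => hw (dotProduct_self_eq_zero.1 h0.symm)
  have hinj : Function.Injective S.mulVecLin := by
    rw [injective_iff_map_eq_zero]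
    intro w hw
    rw [Matrix.mulVecLin_apply] at hw
    have := h1 w
    rw [hw, dotProduct_zero, mul_zero] at this
    exact dotProduct_self_eq_zero.1 (le_antisymm this (hnn w))
  obtain ⟨u, hu⟩ := LinearMap.injective_iff_surjective.1 hinj h
  rw [Matrix.mulVecLin_apply] at hu
  refine ⟨u, hu, hpos u, ?_, ?_⟩
  · set Q := u ⬝ᵥ S.mulVec u with hQ
    have e1 := h1 u
    rcases hpos u with h0 | h0
    · rw [hQ, h0, dotProduct_zero]
      exact mul_nonneg hK.le (hnn h)
    -- Since `Q = u ⬝ h`, Cauchy–Schwarz and the bound `u ⬝ u ≤ K Q` give `Q² ≤ K Q (h ⬝ h)`; one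
    -- factor `Q` cancels.
    · have hcs : Q ^ 2 ≤ (u ⬝ᵥ u) * (h ⬝ᵥ h) := by
        rw [hQ, hu]
        simpa [dotProduct, sq] using Finset.sum_mul_sq_le_sq_mul_sq Finset.univ u h
      have : Q * Q ≤ (K * (h ⬝ᵥ h)) * Q := by
        have := mul_le_mul_of_nonneg_right e1 (hnn h)
        nlinarith
      exact le_of_mul_le_mul_right this h0
  · intro δ hδ
    set Q := u ⬝ᵥ S.mulVec u with hQ
    have e2 := h2 u
    -- For constant `h` the energy sees `u` only through its sum, so the sharper bound by `B`
    -- applies.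
    have hQs : Q = δ * ∑ i, u i := by
      rw [hQ, hu, hδ, Finset.mul_sum]
      exact Finset.sum_congr rfl fun i _ => mul_comm _ _
    rcases hpos u with h0 | h0
    · rw [hQ, h0, dotProduct_zero]
      positivity
    · have : Q * Q ≤ (B * δ ^ 2) * Q := by
        have := mul_le_mul_of_nonneg_left e2 (sq_nonneg δ)
        rw [← hQ] at this
        calc Q * Q = δ ^ 2 * (∑ i, u i) ^ 2 := by rw [hQs]; ring
          _ ≤ _ := by linarith
      exact le_of_mul_le_mul_right this h0

end Spectral

/-! ### The long-memory errors as a Gaussian vector independent of the design -/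

section Noise

/-- The squares decay like `m^{-(α+1)}`, which is summable because `α > 0`. -/
lemma IsLongMemoryFilter.summable_sq {α : ℝ} {a : ℕ → ℝ} (ha : IsLongMemoryFilter α a) :
    Summable fun m => a m ^ 2 := by
  have hp := ha.pos
  have hbd : ∀ᶠ m : ℕ in atTop, ‖a m ^ 2‖ ≤ 4 * (m : ℝ) ^ (-(α + 1)) := by
    have h1 : ∀ᶠ m : ℕ in atTop, |a m * (m : ℝ) ^ ((α + 1) / 2)| ≤ 2 :=
      (ha.tendsto.abs).eventually_le_const (by norm_num)
    filter_upwards [h1, eventually_gt_atTop 0] with m hm hm0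
    have hm0' : (0 : ℝ) < m := by exact_mod_cast hm0
    have h2 : (a m * (m : ℝ) ^ ((α + 1) / 2)) ^ 2 ≤ 4 := by
      rw [← sq_abs]
      nlinarith [abs_nonneg (a m * (m : ℝ) ^ ((α + 1) / 2))]
    have h3 : ((m : ℝ) ^ ((α + 1) / 2)) ^ 2 = (m : ℝ) ^ (α + 1) := by
      rw [← Real.rpow_two, ← Real.rpow_mul hm0'.le]
      congr 1
      ring
    rw [mul_pow, h3] at h2
    rw [Real.norm_of_nonneg (sq_nonneg _), Real.rpow_neg hm0'.le, ← div_eq_mul_inv,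
      le_div_iff₀ (by positivity)]
    exact h2
  refine Summable.of_norm_bounded_eventually_nat (g := fun m : ℕ => 4 * (m : ℝ) ^ (-(α + 1))) ?_ hbd
  exact (Real.summable_nat_rpow.2 (by linarith)).mul_left 4

lemma summable_mul_shift {a : ℕ → ℝ} (ha : Summable fun m => a m ^ 2) (k : ℕ) :
    Summable fun m => a m * a (m + k) := by
  refine Summable.of_norm_bounded (ha.add ((summable_nat_add_iff k).2 ha)) fun m => ?_
  rw [Real.norm_eq_abs, abs_le]
  constructor <;> nlinarith [sq_nonneg (a m - a (m + k)), sq_nonneg (a m + a (m + k)),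
    sq_nonneg (a m), sq_nonneg (a (m + k))]

/-- Only the pairs with `m' = m + k` involve the same innovation. The requirement `m' < n` leaves `m
< n - k`, a partial sum of the autocovariance series. -/
lemma tendsto_sum_autocov_of_le {a : ℕ → ℝ} (ha : Summable fun m => a m ^ 2) (v : ℝ≥0)
    (i k : ℕ) :
    Tendsto (fun n : ℕ => ∑ m ∈ Finset.range n, ∑ m' ∈ Finset.range n,
      a m * a m' * (if (i : ℤ) - (m : ℤ) = ((i + k : ℕ) : ℤ) - (m' : ℤ) then (v : ℝ) else 0))
      atTop (𝓝 (linearAutocov a v k)) := by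
  have h1 : ∀ n : ℕ, (∑ m ∈ Finset.range n, ∑ m' ∈ Finset.range n,
      a m * a m' * (if (i : ℤ) - (m : ℤ) = ((i + k : ℕ) : ℤ) - (m' : ℤ) then (v : ℝ) else 0)) =
      v * ∑ m ∈ Finset.range (n - k), a m * a (m + k) := by
    intro n
    have h2 : ∀ m ∈ Finset.range n, (∑ m' ∈ Finset.range n,
        a m * a m' * (if (i : ℤ) - (m : ℤ) = ((i + k : ℕ) : ℤ) - (m' : ℤ) then (v : ℝ) else 0)) =
        if m ∈ Finset.range (n - k) then v * (a m * a (m + k)) else 0 := by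
      intro m _
      rw [Finset.sum_congr rfl (g := fun m' => if m + k = m' then v * (a m * a (m + k)) else 0)]
      · rw [Finset.sum_ite_eq]
        simp only [Finset.mem_range, Nat.lt_sub_iff_add_lt]
      · intro m' _
        by_cases h : m + k = m'
        · subst h
          rw [if_pos (by push_cast; ring), if_pos rfl]
          ring
        · rw [if_neg (by push_cast; omega), if_neg h, mul_zero]
    rw [Finset.sum_congr rfl h2, ← Finset.sum_filter, Finset.mul_sum]
    congr 1
    ext m
    simp only [Finset.mem_filter, Finset.mem_range]
    omega
  simp_rw [h1]
  exact ((summable_mul_shift ha k).hasSum.tendsto_sum_nat.comp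
    (tendsto_sub_atTop_nat k)).const_mul _

lemma tendsto_sum_autocov {a : ℕ → ℝ} (ha : Summable fun m => a m ^ 2) (v : ℝ≥0) (i j : ℕ) :
    Tendsto (fun n : ℕ => ∑ m ∈ Finset.range n, ∑ m' ∈ Finset.range n,
      a m * a m' * (if (i : ℤ) - (m : ℤ) = (j : ℤ) - (m' : ℤ) then (v : ℝ) else 0))
      atTop (𝓝 (linearAutocov a v ((i : ℤ) - (j : ℤ)).natAbs)) := by
  rcases le_total i j with h | h
  · obtain ⟨k, rfl⟩ := Nat.exists_eq_add_of_le h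
    convert tendsto_sum_autocov_of_le ha v i k using 3
    push_cast
    omega
  · obtain ⟨k, rfl⟩ := Nat.exists_eq_add_of_le h
    have := tendsto_sum_autocov_of_le ha v j k
    convert this using 2 with n
    · rw [Finset.sum_comm]
      refine Finset.sum_congr rfl fun m _ => Finset.sum_congr rfl fun m' _ => ?_
      rw [mul_comm (a m')]
      simp only [eq_comm]
    · congr 1
      push_cast
      omega

variable {Ω : Type*} [MeasurableSpace Ω] {P : Measure Ω}

lemma iIndepFun.isGaussianProcess {ι : Type*} {η : ι → Ω → ℝ} (h : iIndepFun η P)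
    (hG : ∀ k, HasGaussianLaw (η k) P) : IsGaussianProcess η P where
  hasGaussianLaw I := iIndepFun.hasGaussianLaw (X := fun k : I => η k) (fun k => hG k)
    (h.precomp Subtype.val_injective)

/-- The truncated linear process `∑_{m < n} a_m η_{i-m}`. -/
def truncatedNoise (a : ℕ → ℝ) (η : ℤ → Ω → ℝ) (n : ℕ) (i : ℕ) (ω : Ω) : ℝ :=
  ∑ m ∈ Finset.range n, a m * η ((i : ℤ) - (m : ℤ)) ω

variable {T X : ℕ → Ω → ℝ} {η : ℤ → Ω → ℝ} {ε : ℕ → Ω → ℝ}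
  {h₁ h₂ : ℝ → ℝ} {α : ℝ} {a : ℕ → ℝ} {v : ℝ≥0} {κ : ℝ}

namespace IsLongMemoryModel

lemma hasGaussianLaw_innovation (hM : IsLongMemoryModel P T X η ε h₁ h₂ α a v κ) (k : ℤ) :
    HasGaussianLaw (η k) P where
  isGaussian_map := by
    rw [hM.law_η k]
    infer_instance

lemma integral_innovation (hM : IsLongMemoryModel P T X η ε h₁ h₂ α a v κ) (k : ℤ) :
    ∫ ω, η k ω ∂P = 0 := by
  have := integral_map (μ := P) (hM.measurable_η k).aemeasurable (f := fun x : ℝ => x)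
    (by fun_prop : Measurable fun x : ℝ => x).aestronglyMeasurable
  rw [← this, hM.law_η k, integral_id_gaussianReal]

lemma integral_innovation_mul (hM : IsLongMemoryModel P T X η ε h₁ h₂ α a v κ) (k l : ℤ) :
    ∫ ω, η k ω * η l ω ∂P = if k = l then (v : ℝ) else 0 := by
  split_ifs with h
  · subst h
    have h1 : Var[η k; P] = v := by
      have := variance_map (μ := P) (X := fun x : ℝ => x) (Y := η k) (by fun_prop)
        (hM.measurable_η k).aemeasurable
      rw [hM.law_η k, variance_fun_id_gaussianReal] at this
      exact this.symm
    rw [variance_of_integral_eq_zero (hM.measurable_η k).aemeasurable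
      (hM.integral_innovation k)] at h1
    rw [← h1]
    exact integral_congr_ae (Eventually.of_forall fun ω => (sq _).symm)
  · rw [(hM.indep_η.indepFun h).integral_fun_mul_eq_mul_integral
      (hM.measurable_η k).aestronglyMeasurable (hM.measurable_η l).aestronglyMeasurable,
      hM.integral_innovation, zero_mul]

lemma measurable_truncatedNoise (hM : IsLongMemoryModel P T X η ε h₁ h₂ α a v κ) (n i : ℕ) :
    Measurable (truncatedNoise a η n i) := by
  have := hM.measurable_η
  unfold truncatedNoise
  fun_prop

lemma memLp_innovation (hM : IsLongMemoryModel P T X η ε h₁ h₂ α a v κ) (k : ℤ) :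
    MemLp (η k) 2 P := (hM.hasGaussianLaw_innovation k).memLp_two

lemma integral_truncatedNoise_mul (hM : IsLongMemoryModel P T X η ε h₁ h₂ α a v κ) (n i j : ℕ) :
    ∫ ω, truncatedNoise a η n i ω * truncatedNoise a η n j ω ∂P =
      ∑ m ∈ Finset.range n, ∑ m' ∈ Finset.range n,
        a m * a m' * (if (i : ℤ) - (m : ℤ) = (j : ℤ) - (m' : ℤ) then (v : ℝ) else 0) := by
  have hi : ∀ k l : ℤ, Integrable (fun ω => η k ω * η l ω) P := fun k l =>
    (hM.memLp_innovation k).integrable_mul (hM.memLp_innovation l)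
  have : ∀ ω, truncatedNoise a η n i ω * truncatedNoise a η n j ω =
      ∑ m ∈ Finset.range n, ∑ m' ∈ Finset.range n,
        a m * a m' * (η ((i : ℤ) - m) ω * η ((j : ℤ) - m') ω) := by
    intro ω
    rw [truncatedNoise, truncatedNoise, Finset.sum_mul_sum]
    exact Finset.sum_congr rfl fun m _ => Finset.sum_congr rfl fun m' _ => by ring
  simp_rw [this]
  rw [integral_finsetSum _ fun m _ => integrable_finsetSum _ fun m' _ => (hi _ _).const_mul _]
  refine Finset.sum_congr rfl fun m _ => ?_
  rw [integral_finsetSum _ fun m' _ => (hi _ _).const_mul _]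
  refine Finset.sum_congr rfl fun m' _ => ?_
  rw [integral_const_mul, hM.integral_innovation_mul]

lemma hasGaussianLaw_truncatedNoise (hM : IsLongMemoryModel P T X η ε h₁ h₂ α a v κ) {N : ℕ}
    (w : Fin N → ℝ) (n : ℕ) :
    HasGaussianLaw (fun ω => ∑ i, w i * truncatedNoise a η n i ω) P := by
  have h1 := iIndepFun.isGaussianProcess hM.indep_η hM.hasGaussianLaw_innovation
  have h2 := (h1.comp_right fun z : Fin N × ℕ => ((z.1 : ℕ) : ℤ) - (z.2 : ℤ)).smul
    fun z => w z.1 * a z.2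
  have h3 := h2.hasGaussianLaw_fun_sum (I := Finset.univ ×ˢ Finset.range n)
  have heq : (fun ω => ∑ i, w i * truncatedNoise a η n i ω) = fun ω =>
      ∑ z ∈ Finset.univ ×ˢ Finset.range n,
        (w z.1 * a z.2) • (η ∘ fun z : Fin N × ℕ => ((z.1 : ℕ) : ℤ) - (z.2 : ℤ)) z ω := by
    ext ω
    rw [Finset.sum_product]
    simp [truncatedNoise, Finset.mul_sum, mul_assoc]
  rw [heq]
  exact h3

lemma memLp_truncatedNoise (hM : IsLongMemoryModel P T X η ε h₁ h₂ α a v κ) (n i : ℕ) :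
    MemLp (truncatedNoise a η n i) 2 P :=
  memLp_finsetSum _ fun m _ => (hM.memLp_innovation _).const_mul (a m)

/-- A truncated process is a finite combination of independent Gaussians, so its characteristic
function is explicit. The one of the errors is obtained as the limit in `n`. -/
lemma integral_exp_truncatedNoise (hM : IsLongMemoryModel P T X η ε h₁ h₂ α a v κ) {N : ℕ}
    (w : Fin N → ℝ) (n : ℕ) :
    ∫ ω, Complex.exp ((∑ i, w i * truncatedNoise a η n i ω : ℝ) * Complex.I) ∂P =
      Complex.exp (-((∑ i, ∑ j, w i * w j *
        ∫ ω, truncatedNoise a η n i ω * truncatedNoise a η n j ω ∂P : ℝ) : ℂ) / 2) := by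
  set Y : Ω → ℝ := fun ω => ∑ i, w i * truncatedNoise a η n i ω with hY
  have hG : HasGaussianLaw Y P := hM.hasGaussianLaw_truncatedNoise w n
  have hmean : ∫ ω, Y ω ∂P = 0 := by
    simp only [hY, truncatedNoise]
    have hint : ∀ k, Integrable (η k) P := fun k => (hM.hasGaussianLaw_innovation k).integrable
    rw [integral_finsetSum _ fun i _ => (integrable_finsetSum _ fun m _ =>
      (hint _).const_mul _).const_mul _]
    refine Finset.sum_eq_zero fun i _ => ?_
    rw [integral_const_mul, integral_finsetSum _ fun m _ => (hint _).const_mul _]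
    simp [integral_const_mul, hM.integral_innovation]
  have hvar : Var[Y; P] = ∑ i, ∑ j, w i * w j *
        ∫ ω, truncatedNoise a η n i ω * truncatedNoise a η n j ω ∂P := by
    have hi : ∀ k l : ℕ, Integrable
        (fun ω => truncatedNoise a η n k ω * truncatedNoise a η n l ω) P := fun k l =>
      (hM.memLp_truncatedNoise n k).integrable_mul (hM.memLp_truncatedNoise n l)
    rw [variance_of_integral_eq_zero hG.aemeasurable hmean]
    have : ∀ ω, Y ω ^ 2 = ∑ i : Fin N, ∑ j : Fin N, w i * w j *
        (truncatedNoise a η n i ω * truncatedNoise a η n j ω) := by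
      intro ω
      rw [hY, sq, Finset.sum_mul_sum]
      exact Finset.sum_congr rfl fun i _ => Finset.sum_congr rfl fun j _ => by ring
    simp_rw [this]
    rw [integral_finsetSum _ fun i _ => integrable_finsetSum _ fun j _ => (hi _ _).const_mul _]
    refine Finset.sum_congr rfl fun i _ => ?_
    rw [integral_finsetSum _ fun j _ => (hi _ _).const_mul _]
    exact Finset.sum_congr rfl fun j _ => integral_const_mul _ _
  have h1 := hG.map_eq_gaussianReal
  have h2 := integral_map hG.aemeasurable
    (f := fun y : ℝ => Complex.exp (((1 : ℝ) : ℂ) * y * Complex.I))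
    (by fun_prop : Measurable _).aestronglyMeasurable
  rw [← charFun_apply_real, h1, charFun_gaussianReal, hmean] at h2
  rw [← hvar]
  simp only [Complex.ofReal_one, one_mul] at h2
  rw [← h2]
  congr 1
  rw [Real.coe_toNNReal _ (variance_nonneg _ _)]
  push_cast
  ring

lemma tendsto_eLpNorm_truncatedNoise (hM : IsLongMemoryModel P T X η ε h₁ h₂ α a v κ) {N : ℕ}
    (w : Fin N → ℝ) :
    Tendsto (fun n => eLpNorm ((fun ω => ∑ i, w i * truncatedNoise a η n i ω) -
      fun ω => ∑ i : Fin N, w i * ε i ω) 2 P) atTop (𝓝 0) := by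
  have hbound : ∀ n, eLpNorm ((fun ω => ∑ i, w i * truncatedNoise a η n i ω) -
      fun ω => ∑ i : Fin N, w i * ε i ω) 2 P ≤
      ∑ i : Fin N, ‖w i‖ₑ * eLpNorm (fun ω => ε i ω -
        ∑ m ∈ Finset.range n, a m * η (((i : ℕ) : ℤ) - (m : ℤ)) ω) 2 P := by
    intro n
    have : ((fun ω => ∑ i, w i * truncatedNoise a η n i ω) -
        fun ω => ∑ i : Fin N, w i * ε i ω) =
        ∑ i : Fin N, (-w i) • fun ω => ε i ω - truncatedNoise a η n i ω := by
      ext ω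
      simp only [Pi.sub_apply, Finset.sum_apply, Pi.smul_apply, smul_eq_mul,
        ← Finset.sum_sub_distrib]
      exact Finset.sum_congr rfl fun i _ => by ring
    rw [this]
    refine (eLpNorm_sum_le (fun i _ => ?_) (by norm_num)).trans ?_
    · exact (((hM.measurable_ε i).sub
        (hM.measurable_truncatedNoise n i)).aestronglyMeasurable).const_smul _
    · gcongr with i
      rw [eLpNorm_const_smul, enorm_neg]
      rfl
  refine tendsto_of_tendsto_of_tendsto_of_le_of_le tendsto_const_nhds ?_ (fun _ => zero_le)
    hbound
  have := tendsto_finsetSum Finset.univ fun (i : Fin N) _ =>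
    ENNReal.Tendsto.const_mul (a := ‖w i‖ₑ) (hM.linear i) (Or.inr enorm_ne_top)
  simpa using this

/-- The errors form a centred Gaussian vector with the Toeplitz covariance matrix of the linear
process. -/
lemma hasGaussianCharFun_noise [IsProbabilityMeasure P]
    (hM : IsLongMemoryModel P T X η ε h₁ h₂ α a v κ)
    (ha : IsLongMemoryFilter α a) (N : ℕ) :
    HasGaussianCharFun (P.map fun ω (i : Fin N) => ε i ω) (toeplitz (linearAutocov a v) N) := by
  intro w
  have hεm : Measurable fun ω (i : Fin N) => ε i ω :=
    measurable_pi_lambda _ fun i => hM.measurable_ε i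
  have hmw := measurable_dotProduct_left w
  rw [integral_map hεm.aemeasurable (by fun_prop)]
  have hYm : ∀ n, Measurable fun ω => ∑ i : Fin N, w i * truncatedNoise a η n i ω := by
    intro n
    have := hM.measurable_truncatedNoise n
    fun_prop
  have hZm : Measurable fun ω => ∑ i : Fin N, w i * ε i ω := by
    have := hM.measurable_ε
    fun_prop
  -- Convergence in `L²` yields almost sure convergence along a subsequence, enough for dominated
  -- convergence of the bounded exponentials.
  obtain ⟨ns, hns, hlim⟩ := (tendstoInMeasure_of_tendsto_eLpNorm (by norm_num)
    (fun n => (hYm n).aestronglyMeasurable) hZm.aestronglyMeasurable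
    (hM.tendsto_eLpNorm_truncatedNoise w)).exists_seq_tendsto_ae
  have hL : Tendsto (fun k => ∫ ω, Complex.exp
      ((∑ i, w i * truncatedNoise a η (ns k) i ω : ℝ) * Complex.I) ∂P) atTop
      (𝓝 (∫ ω, Complex.exp ((∑ i : Fin N, w i * ε i ω : ℝ) * Complex.I) ∂P)) := by
    refine tendsto_integral_of_dominated_convergence (fun _ => 1) (fun k => ?_)
      (integrable_const _) (fun k => ?_) ?_
    · have := hYm (ns k)
      exact (by fun_prop : Measurable fun ω => Complex.exp
        ((∑ i, w i * truncatedNoise a η (ns k) i ω : ℝ) * Complex.I)).aestronglyMeasurable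
    · exact Eventually.of_forall fun ω => by rw [Complex.norm_exp_ofReal_mul_I]
    · filter_upwards [hlim] with ω hω
      exact ((Complex.continuous_exp.comp
        (Complex.continuous_ofReal.mul continuous_const)).tendsto _).comp hω
  have hR : Tendsto (fun n => ∫ ω, Complex.exp
      ((∑ i, w i * truncatedNoise a η n i ω : ℝ) * Complex.I) ∂P) atTop
      (𝓝 (Complex.exp (-((w ⬝ᵥ (toeplitz (linearAutocov a v) N).mulVec w : ℝ) : ℂ) / 2))) := by
    simp_rw [hM.integral_exp_truncatedNoise]
    have h1 : Tendsto (fun n => ∑ i : Fin N, ∑ j : Fin N, w i * w j *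
        ∫ ω, truncatedNoise a η n i ω * truncatedNoise a η n j ω ∂P) atTop
        (𝓝 (w ⬝ᵥ (toeplitz (linearAutocov a v) N).mulVec w)) := by
      simp_rw [hM.integral_truncatedNoise_mul]
      have : w ⬝ᵥ (toeplitz (linearAutocov a v) N).mulVec w = ∑ i : Fin N, ∑ j : Fin N,
          w i * w j * linearAutocov a v (((i : ℕ) : ℤ) - ((j : ℕ) : ℤ)).natAbs := by
        simp only [dotProduct, Matrix.mulVec, toeplitz, Matrix.of_apply, Finset.mul_sum]
        exact Finset.sum_congr rfl fun i _ => Finset.sum_congr rfl fun j _ => by ring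
      rw [this]
      exact tendsto_finsetSum _ fun i _ => tendsto_finsetSum _ fun j _ =>
        (tendsto_sum_autocov ha.summable_sq v i j).const_mul _
    exact ((by fun_prop : Continuous fun x : ℝ => Complex.exp (-(x : ℂ) / 2)).tendsto _).comp h1
  exact tendsto_nhds_unique hL (hR.comp hns.tendsto_atTop)

/-- The errors are independent of the design. -/
lemma indepFun_design_noise (hM : IsLongMemoryModel P T X η ε h₁ h₂ α a v κ) (N : ℕ) :
    IndepFun (fun ω (i : Fin N) => (T i ω, X i ω)) (fun ω (i : Fin N) => ε i ω) P := by
  have hex : ∀ i : ℕ, ∃ G : (ℤ → ℝ) → ℝ, Measurable G ∧ ∀ᵐ ω ∂P, G (fun k => η k ω) = ε i ω := by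
    intro i
    have h1 : Tendsto (fun n => eLpNorm (truncatedNoise a η n i - ε i) 2 P) atTop (𝓝 0) := by
      convert hM.linear i using 2 with n
      rw [← eLpNorm_neg]
      congr 1
      ext ω
      simp [truncatedNoise]
    obtain ⟨ns, -, hlim⟩ := (tendstoInMeasure_of_tendsto_eLpNorm (by norm_num)
      (fun n => (hM.measurable_truncatedNoise n i).aestronglyMeasurable)
      (hM.measurable_ε i).aestronglyMeasurable h1).exists_seq_tendsto_ae
    -- The `limsup` gives an everywhere defined measurable function of the innovations that equals
    -- `ε i` almost surely. Independence from the design then passes from `η` to the errors.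
    refine ⟨fun x => limsup (fun k => ∑ m ∈ Finset.range (ns k), a m * x ((i : ℤ) - (m : ℤ))) atTop,
      Measurable.limsup fun k => by fun_prop, ?_⟩
    filter_upwards [hlim] with ω hω
    exact hω.limsup_eq
  choose G hGm hG using hex
  have h1 := hM.indep_design_noise.comp
    (φ := fun z : (ℕ → ℝ) × (ℕ → ℝ) => fun i : Fin N => (z.1 i, z.2 i))
    (ψ := fun x : ℤ → ℝ => fun i : Fin N => G i x) (by fun_prop) (by fun_prop)
  refine h1.congr (Eventually.of_forall fun ω => rfl) ?_
  filter_upwards [ae_all_iff.2 hG] with ω hω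
  ext i
  exact hω i

end IsLongMemoryModel

end Noise

/-! ### Assouad's reduction to pairs of hypotheses -/

section LowerBound

lemma sum_sq_integral_mul_le {Z ι : Type*} [MeasurableSpace Z] {μ : Measure Z} [Fintype ι]
    [DecidableEq ι] {Ψ : ι → Z → ℝ} (hΨ : ∀ k, MemLp (Ψ k) 2 μ)
    (horth : ∀ k l, ∫ z, Ψ k z * Ψ l z ∂μ = if k = l then 1 else 0) {g : Z → ℝ}
    (hg : MemLp g 2 μ) : ∑ k, (∫ z, g z * Ψ k z ∂μ) ^ 2 ≤ ∫ z, g z ^ 2 ∂μ := by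
  have hinner : ∀ {f₁ f₂ : Z → ℝ} (h₁ : MemLp f₁ 2 μ) (h₂ : MemLp f₂ 2 μ),
      inner ℝ (h₁.toLp f₁) (h₂.toLp f₂) = ∫ z, f₂ z * f₁ z ∂μ := by
    intro f₁ f₂ h₁ h₂
    rw [L2.inner_def]
    refine integral_congr_ae ?_
    filter_upwards [h₁.coeFn_toLp, h₂.coeFn_toLp] with z e1 e2
    rw [e1, e2]
    rfl
  have hon : Orthonormal ℝ fun k => (hΨ k).toLp (Ψ k) := by
    rw [orthonormal_iff_ite]
    intro k l
    rw [hinner, horth]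
    simp only [eq_comm]
  have := hon.sum_inner_products_le (hg.toLp g) (s := Finset.univ)
  simp only [hinner, Real.norm_eq_abs, sq_abs] at this
  rw [← real_inner_self_eq_norm_sq, hinner] at this
  simpa only [sq] using this

/-- The design points `(t_i, x_i)` and errors `ε_i` combine to the observations. -/
def observationMap (σ : ℝ) (θ : AdditiveFn) {N : ℕ} (z : (Fin N → ℝ × ℝ) × (Fin N → ℝ)) :
    Fin N → ℝ × ℝ × ℝ :=
  fun i => ((z.1 i).1, (z.1 i).2, θ.eval (z.1 i) + σ * z.2 i)

lemma measurable_observationMap (σ : ℝ) {θ : AdditiveFn} (hθ : Measurable θ.eval) (N : ℕ) :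
    Measurable (observationMap σ θ (N := N)) := by
  unfold observationMap
  fun_prop

variable {Ω : Type*} [MeasurableSpace Ω] {P : Measure Ω} [IsProbabilityMeasure P]
  {T X : ℕ → Ω → ℝ} {η : ℤ → Ω → ℝ} {ε : ℕ → Ω → ℝ}
  {h₁ h₂ : ℝ → ℝ} {α : ℝ} {a : ℕ → ℝ} {v : ℝ≥0} {κ σ : ℝ}

/-- Two regression functions which differ by `δ` cannot be told apart if the mean energy of the
shift `δ / σ` relative to the covariance of the errors is small. -/
lemma IsLongMemoryModel.two_point (hM : IsLongMemoryModel P T X η ε h₁ h₂ α a v κ)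
    (ha : IsLongMemoryFilter α a) (hσ : 0 < σ) {N : ℕ} {θ₀ θ₁ : AdditiveFn}
    (hθ₀ : Measurable θ₀.eval) (hθ₁ : Measurable θ₁.eval) {δ : ℝ × ℝ → ℝ}
    (hδ : ∀ z, θ₁.eval z = θ₀.eval z + δ z) {q : (Fin N → ℝ × ℝ) → ℝ} (hqm : Measurable q)
    (hu : ∀ x : Fin N → ℝ × ℝ, ∃ u : Fin N → ℝ,
      (toeplitz (linearAutocov a v) N).mulVec u = (fun i => δ (x i) / σ) ∧
      ((toeplitz (linearAutocov a v) N).mulVec u = 0 ∨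
        0 < u ⬝ᵥ (toeplitz (linearAutocov a v) N).mulVec u) ∧
      u ⬝ᵥ (toeplitz (linearAutocov a v) N).mulVec u ≤ q x)
    (hq : ∫⁻ ω, ENNReal.ofReal (3 / 2 * q fun i => (T i ω, X i ω)) ∂P ≤ ENNReal.ofReal (1 / 4))
    {F G : (Fin N → ℝ × ℝ × ℝ) → ℝ≥0∞} (hF : Measurable F) (hG : Measurable G)
    {D : ℝ≥0∞} (hDtop : D ≠ ∞) (hD : ∀ y, D ≤ F y + G y) :
    D * ENNReal.ofReal (1 / 2) ≤ ∫⁻ ω, F (observations T X ε σ θ₀ N ω) ∂P +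
      ∫⁻ ω, G (observations T X ε σ θ₁ N ω) ∂P := by
  set μ := P.map fun ω (i : Fin N) => ε i ω with hμ
  set ν := P.map fun ω (i : Fin N) => (T i ω, X i ω) with hν
  have hTm := hM.measurable_T
  have hXm := hM.measurable_X
  have hεm := hM.measurable_ε
  have hdm : Measurable fun ω (i : Fin N) => (T i ω, X i ω) := by fun_prop
  have hem : Measurable fun ω (i : Fin N) => ε i ω := by fun_prop
  have : IsProbabilityMeasure μ := Measure.isProbabilityMeasure_map hem.aemeasurable
  have : IsProbabilityMeasure ν := Measure.isProbabilityMeasure_map hdm.aemeasurable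
  have hprod := (indepFun_iff_map_prod_eq_prod_map_map hdm.aemeasurable hem.aemeasurable).1
    (hM.indepFun_design_noise N)
  have hlaw : ∀ {H : (Fin N → ℝ × ℝ × ℝ) → ℝ≥0∞} {θ : AdditiveFn}, Measurable H →
      Measurable θ.eval → ∫⁻ ω, H (observations T X ε σ θ N ω) ∂P =
        ∫⁻ x, ∫⁻ e, H (observationMap σ θ (x, e)) ∂μ ∂ν := by
    intro H θ hH hθ
    have hm : Measurable fun z : (Fin N → ℝ × ℝ) × (Fin N → ℝ) => H (observationMap σ θ z) :=
      hH.comp (measurable_observationMap σ hθ N)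
    rw [← lintegral_prod (fun z => H (observationMap σ θ z)) hm.aemeasurable, ← hprod,
      lintegral_map hm (hdm.prodMk hem)]
    rfl
  rw [hlaw hF hθ₀, hlaw hG hθ₁]
  have hchar := hM.hasGaussianCharFun_noise ha N
  have hpoint : ∀ x : Fin N → ℝ × ℝ, D * ENNReal.ofReal (3 / 4) ≤
      ∫⁻ e, F (observationMap σ θ₀ (x, e)) ∂μ + ∫⁻ e, G (observationMap σ θ₁ (x, e)) ∂μ +
        D * ENNReal.ofReal (3 / 2 * q x) := by
    intro x
    obtain ⟨u, hu1, hu2, hu3⟩ := hu x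
    -- For a fixed design, changing the regression function amounts to translating the error vector
    -- by `S u = δ / σ`.
    have hshift : ∀ e : Fin N → ℝ, observationMap σ θ₁ (x, e) = observationMap σ θ₀
        (x, e + (toeplitz (linearAutocov a v) N).mulVec u) := by
      intro e
      ext i <;> simp only [observationMap]
      rw [hu1, Pi.add_apply, hδ]
      field_simp
      ring
    have hm0 : Measurable fun e : Fin N → ℝ => observationMap σ θ₀ (x, e) :=
      (measurable_observationMap σ hθ₀ N).comp measurable_prodMk_left
    have := hchar.two_point (toeplitz_isSymm _ N) u hu2
      (F := fun e => F (observationMap σ θ₀ (x, e)))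
      (G := fun e => G (observationMap σ θ₀ (x, e))) (hF.comp hm0) (hG.comp hm0) D
      (fun e => hD _)
    simp_rw [hshift]
    refine this.trans ?_
    gcongr
  have hmF : Measurable fun x => ∫⁻ e, F (observationMap σ θ₀ (x, e)) ∂μ :=
    (hF.comp (measurable_observationMap σ hθ₀ N)).lintegral_prod_right'
  have hmG : Measurable fun x => ∫⁻ e, G (observationMap σ θ₁ (x, e)) ∂μ :=
    (hG.comp (measurable_observationMap σ hθ₁ N)).lintegral_prod_right'
  have hqν : ∫⁻ x, ENNReal.ofReal (3 / 2 * q x) ∂ν ≤ ENNReal.ofReal (1 / 4) := by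
    rwa [hν, lintegral_map (by fun_prop) hdm]
  have hint : D * ENNReal.ofReal (3 / 4) ≤
      ∫⁻ x, ∫⁻ e, F (observationMap σ θ₀ (x, e)) ∂μ ∂ν +
        ∫⁻ x, ∫⁻ e, G (observationMap σ θ₁ (x, e)) ∂μ ∂ν + D * ENNReal.ofReal (1 / 4) := by
    calc D * ENNReal.ofReal (3 / 4) = ∫⁻ _, D * ENNReal.ofReal (3 / 4) ∂ν := by simp
      _ ≤ _ := lintegral_mono hpoint
      _ = ∫⁻ x, ∫⁻ e, F (observationMap σ θ₀ (x, e)) ∂μ ∂ν +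
        ∫⁻ x, ∫⁻ e, G (observationMap σ θ₁ (x, e)) ∂μ ∂ν +
          D * ∫⁻ x, ENNReal.ofReal (3 / 2 * q x) ∂ν := by
        rw [lintegral_add_left (hmF.fun_add hmG), lintegral_add_left hmF,
          lintegral_const_mul _ (by fun_prop)]
      _ ≤ _ := by gcongr
  -- The averaged energy costs `D / 4` out of `3D / 4`; cancelling it requires `D` to be finite.
  have hsplit : D * ENNReal.ofReal (3 / 4) =
      D * ENNReal.ofReal (1 / 2) + D * ENNReal.ofReal (1 / 4) := by
    rw [← mul_add, ← ENNReal.ofReal_add (by norm_num) (by norm_num)]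
    norm_num
  rw [hsplit] at hint
  exact (ENNReal.add_le_add_iff_right (ENNReal.mul_ne_top hDtop ENNReal.ofReal_ne_top)).1 hint

/-- The unit square. -/
abbrev unitSquare : Set (ℝ × ℝ) := Set.Icc (0 : ℝ) 1 ×ˢ Set.Icc (0 : ℝ) 1

/-- The sign encoded by a Boolean. -/
def boolSign (b : Bool) : ℝ := if b then 1 else -1

lemma abs_boolSign (b : Bool) : |boolSign b| = 1 := by
  cases b <;> simp [boolSign]

instance : IsProbabilityMeasure (volume.restrict unitSquare) where
  measure_univ := by
    rw [Measure.restrict_apply_univ, Measure.volume_eq_prod, Measure.prod_prod]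
    simp

/-- Bessel's inequality for the error function. When the loss is infinite there is nothing to prove,
so no integrability of the estimator is needed. -/
lemma sum_sq_coordinate_le_loss {ι : Type*} [Fintype ι] [DecidableEq ι] {Ψ : ι → ℝ × ℝ → ℝ}
    (hΨm : ∀ k, Measurable (Ψ k)) {b : ℝ} (hΨb : ∀ k z, |Ψ k z| ≤ b)
    (horth : ∀ k l, ∫ z in unitSquare, Ψ k z * Ψ l z = if k = l then 1 else 0)
    (β : ℝ) (c : ι → ℝ) {e : ℝ × ℝ → ℝ} (he : Measurable e) :
    ∑ k, ENNReal.ofReal (((∫ z in unitSquare, (e z - β) * Ψ k z) - c k) ^ 2) ≤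
      ∫⁻ z in unitSquare, ENNReal.ofReal ((e z - (β + ∑ k, c k * Ψ k z)) ^ 2) := by
  set μ := (volume : Measure (ℝ × ℝ)).restrict unitSquare
  have hΨL : ∀ k, MemLp (Ψ k) 2 μ := fun k =>
    MemLp.of_bound (hΨm k).aestronglyMeasurable b (Eventually.of_forall fun z => hΨb k z)
  set g : ℝ × ℝ → ℝ := fun z => e z - (β + ∑ k, c k * Ψ k z) with hg
  have hgm : Measurable g := by fun_prop
  by_cases htop : ∫⁻ z, ENNReal.ofReal (g z ^ 2) ∂μ = ∞
  · rw [htop]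
    exact le_top
  have hgi : Integrable (fun z => g z ^ 2) μ := by
    refine ⟨by fun_prop, ?_⟩
    rw [hasFiniteIntegral_iff_ofReal (Eventually.of_forall fun z => sq_nonneg _)]
    exact lt_top_iff_ne_top.2 htop
  have hgL : MemLp g 2 μ := (memLp_two_iff_integrable_sq hgm.aestronglyMeasurable).2 hgi
  have hcoord : ∀ k, (∫ z, (e z - β) * Ψ k z ∂μ) - c k = ∫ z, g z * Ψ k z ∂μ := by
    intro k
    have hexp : ∀ z, (e z - β) * Ψ k z = g z * Ψ k z + ∑ l, c l * (Ψ l z * Ψ k z) := by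
      intro z
      simp only [hg, ← mul_assoc]
      rw [← Finset.sum_mul]
      ring
    have hgi' : Integrable (fun z => g z * Ψ k z) μ := hgL.integrable_mul (hΨL k)
    have hi : ∀ l, Integrable (fun z => Ψ l z * Ψ k z) μ := fun l =>
      (hΨL l).integrable_mul (hΨL k)
    simp_rw [hexp]
    rw [integral_add hgi'
      (integrable_finsetSum _ fun l _ => (hi l).const_mul _),
      integral_finsetSum _ fun l _ => (hi l).const_mul _]
    simp_rw [integral_const_mul, horth]
    simp
  calc ∑ k, ENNReal.ofReal (((∫ z, (e z - β) * Ψ k z ∂μ) - c k) ^ 2)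
      = ENNReal.ofReal (∑ k, (∫ z, g z * Ψ k z ∂μ) ^ 2) := by
        rw [ENNReal.ofReal_sum_of_nonneg fun k _ => sq_nonneg _]
        simp_rw [hcoord]
    _ ≤ ENNReal.ofReal (∫ z, g z ^ 2 ∂μ) :=
        ENNReal.ofReal_le_ofReal (sum_sq_integral_mul_le hΨL horth hgL)
    _ = _ := ofReal_integral_eq_lintegral_ofReal hgi (Eventually.of_forall fun z => sq_nonneg _)

/-- Flipping coordinate `k` is an involution of the cube, so summing the pair bound over all
vertices counts each `t τ` twice. -/
lemma sum_cube_le_of_pair {ι : Type*} [Fintype ι] [DecidableEq ι] (k : ι)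
    (t : (ι → Bool) → ℝ≥0∞) {y : ℝ≥0∞}
    (h : ∀ τ, y ≤ t (Function.update τ k false) + t (Function.update τ k true)) :
    Fintype.card (ι → Bool) * y ≤ 2 * ∑ τ, t τ := by
  set flip : (ι → Bool) → (ι → Bool) := fun τ => Function.update τ k (!τ k) with hflip
  have hinv : Function.Involutive flip := by
    intro τ
    simp [hflip]
  have hsum : ∑ τ, t (flip τ) = ∑ τ, t τ := Equiv.sum_comp hinv.toPerm t
  have hpair : ∀ τ, y ≤ t τ + t (flip τ) := by
    intro τ
    have := h τ
    rcases hτ : τ k with _ | _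
    · rwa [show Function.update τ k false = τ by rw [← hτ, Function.update_eq_self],
        show Function.update τ k true = flip τ by simp [hflip, hτ]] at this
    · rwa [show Function.update τ k true = τ by rw [← hτ, Function.update_eq_self],
        show Function.update τ k false = flip τ by simp [hflip, hτ], add_comm] at this
  calc Fintype.card (ι → Bool) * y = ∑ _τ : ι → Bool, y := by simp
    _ ≤ ∑ τ, (t τ + t (flip τ)) := Finset.sum_le_sum fun τ _ => hpair τ
    _ = _ := by rw [Finset.sum_add_distrib, hsum, two_mul]

/-- Assouad's lower bound over a cube of regression functions in an orthonormal system. -/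
lemma IsLongMemoryModel.le_additiveMinimaxRisk
    (hM : IsLongMemoryModel P T X η ε h₁ h₂ α a v κ)
    (ha : IsLongMemoryFilter α a) (hσ : 0 < σ) {N : ℕ} {Θ : Set AdditiveFn}
    {ι : Type*} [Fintype ι] [DecidableEq ι] {Ψ : ι → ℝ × ℝ → ℝ}
    (hΨm : ∀ k, Measurable (Ψ k)) {b : ℝ} (hΨb : ∀ k z, |Ψ k z| ≤ b)
    (horth : ∀ k l, ∫ z in unitSquare, Ψ k z * Ψ l z = if k = l then 1 else 0)
    {β γ : ℝ} {θ : (ι → Bool) → AdditiveFn} (hθ : ∀ τ, θ τ ∈ Θ)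
    (hθe : ∀ τ z, (θ τ).eval z = β + ∑ k, γ * boolSign (τ k) * Ψ k z)
    {q : ι → (Fin N → ℝ × ℝ) → ℝ} (hqm : ∀ k, Measurable (q k))
    (hu : ∀ k, ∀ x : Fin N → ℝ × ℝ, ∃ u : Fin N → ℝ,
      (toeplitz (linearAutocov a v) N).mulVec u = (fun i => 2 * γ * Ψ k (x i) / σ) ∧
      ((toeplitz (linearAutocov a v) N).mulVec u = 0 ∨
        0 < u ⬝ᵥ (toeplitz (linearAutocov a v) N).mulVec u) ∧
      u ⬝ᵥ (toeplitz (linearAutocov a v) N).mulVec u ≤ q k x)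
    (hq : ∀ k, ∫⁻ ω, ENNReal.ofReal (3 / 2 * q k fun i => (T i ω, X i ω)) ∂P ≤
      ENNReal.ofReal (1 / 4)) :
    ENNReal.ofReal (Fintype.card ι * γ ^ 2 / 2) ≤ additiveMinimaxRisk P T X ε σ N Θ := by
  refine le_iInf₂ fun est hest => ?_
  set s := ⨆ ϑ ∈ Θ, risk P T X ε σ N est ϑ with hs
  -- Projection turns an estimator of the function into a scalar estimator of each coefficient `γ *
  -- boolSign (τ k)`.
  set c : ι → (Fin N → ℝ × ℝ × ℝ) → ℝ :=
    fun k y => ∫ z in unitSquare, (est y z - β) * Ψ k z with hc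
  have hcm : ∀ k, Measurable (c k) := by
    intro k
    have : StronglyMeasurable (Function.uncurry fun y z => (est y z - β) * Ψ k z) := by
      refine Measurable.stronglyMeasurable ?_
      exact (hest.sub_const β).mul ((hΨm k).comp measurable_snd)
    exact this.integral_prod_right.measurable
  have hθm : ∀ τ, Measurable (θ τ).eval := by
    intro τ
    rw [show (θ τ).eval = fun z => β + ∑ k, γ * boolSign (τ k) * Ψ k z from funext (hθe τ)]
    fun_prop
  have hTm := hM.measurable_T
  have hXm := hM.measurable_X
  have hεm := hM.measurable_ε
  have hobs : ∀ τ, Measurable (observations T X ε σ (θ τ) N) := by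
    intro τ
    have := hθm τ
    unfold observations
    fun_prop
  set t : ι → (ι → Bool) → ℝ≥0∞ := fun k τ => ∫⁻ ω,
    ENNReal.ofReal ((c k (observations T X ε σ (θ τ) N ω) - γ * boolSign (τ k)) ^ 2) ∂P with ht
  have hrisk : ∀ τ, ∑ k, t k τ ≤ s := by
    intro τ
    refine le_trans ?_ (le_iSup₂_of_le (θ τ) (hθ τ) le_rfl)
    simp only [ht, risk]
    rw [← lintegral_finsetSum]
    · refine lintegral_mono fun ω => ?_
      simp only [hθe]
      exact sum_sq_coordinate_le_loss hΨm hΨb horth β (fun k => γ * boolSign (τ k))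
        (hest.comp measurable_prodMk_left)
    · intro k _
      have := (hcm k).comp (hobs τ)
      simp only [Function.comp_def] at this
      fun_prop
  have hpair : ∀ k τ, ENNReal.ofReal (2 * γ ^ 2) * ENNReal.ofReal (1 / 2) ≤
      t k (Function.update τ k false) + t k (Function.update τ k true) := by
    intro k τ
    have hck := hcm k
    have := hM.two_point ha hσ (hθm (Function.update τ k false)) (hθm (Function.update τ k true))
      (δ := fun z => 2 * γ * Ψ k z) (fun z => ?_) (hqm k) (hu k) (hq k)
      (F := fun y => ENNReal.ofReal ((c k y - γ * boolSign false) ^ 2))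
      (G := fun y => ENNReal.ofReal ((c k y - γ * boolSign true) ^ 2))
      (by fun_prop) (by fun_prop) (D := ENNReal.ofReal (2 * γ ^ 2)) ENNReal.ofReal_ne_top
      (fun y => ?_)
    · simpa [ht] using this
    · rw [hθe, hθe, add_assoc, ← Finset.add_sum_erase _ _ (Finset.mem_univ k),
        ← Finset.add_sum_erase (Finset.univ) (fun l => γ * boolSign
          (Function.update τ k false l) * Ψ l z) (Finset.mem_univ k),
        Finset.sum_congr rfl (s₁ := Finset.univ.erase k) (g := fun l => γ * boolSign
          (Function.update τ k false l) * Ψ l z)]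
      · simp [boolSign]
        ring
      · intro l hl
        rw [Function.update_of_ne (Finset.ne_of_mem_erase hl),
          Function.update_of_ne (Finset.ne_of_mem_erase hl)]
    -- For any real `c`, `(c + γ)² + (c - γ)² ≥ 2γ²`; this is the separation `D` of the two
    -- hypotheses.
    · rw [← ENNReal.ofReal_add (sq_nonneg _) (sq_nonneg _)]
      refine ENNReal.ofReal_le_ofReal ?_
      simp only [boolSign, if_true, Bool.false_eq_true, if_false]
      nlinarith [sq_nonneg (c k y)]
  rw [← ENNReal.ofReal_mul (by positivity), show 2 * γ ^ 2 * (1 / 2) = γ ^ 2 by ring] at hpair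
  have hcard : (Fintype.card (ι → Bool) : ℝ≥0∞) ≠ 0 := by simp
  have hcard' : (Fintype.card (ι → Bool) : ℝ≥0∞) ≠ ∞ := ENNReal.natCast_ne_top _
  have hmain : (Fintype.card (ι → Bool) : ℝ≥0∞) * (Fintype.card ι * ENNReal.ofReal (γ ^ 2)) ≤
      (Fintype.card (ι → Bool) : ℝ≥0∞) * (2 * s) := by
    calc (Fintype.card (ι → Bool) : ℝ≥0∞) * (Fintype.card ι * ENNReal.ofReal (γ ^ 2))
        = ∑ _k : ι, (Fintype.card (ι → Bool) : ℝ≥0∞) * ENNReal.ofReal (γ ^ 2) := by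
          rw [Finset.sum_const, Finset.card_univ, nsmul_eq_mul]
          ring
      _ ≤ ∑ k, 2 * ∑ τ, t k τ := Finset.sum_le_sum fun k _ => sum_cube_le_of_pair k (t k) (hpair k)
      _ = 2 * ∑ τ, ∑ k, t k τ := by rw [← Finset.mul_sum, Finset.sum_comm]
      _ ≤ 2 * ∑ _τ : ι → Bool, s := by
          gcongr with τ
          exact hrisk τ
      _ = _ := by
          rw [Finset.sum_const, Finset.card_univ, nsmul_eq_mul]
          ring
  have h2 := (ENNReal.mul_le_mul_iff_right hcard hcard').1 hmain
  rw [ENNReal.ofReal_div_of_pos two_pos, ENNReal.ofReal_mul (Nat.cast_nonneg _),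
    ENNReal.ofReal_natCast]
  refine ENNReal.div_le_of_le_mul ?_
  rw [mul_comm s]
  simpa using h2

end LowerBound

/-! ### Periodized wavelets: finite sums, bounds, orthonormality, Besov membership -/

section Wavelet

variable {ψ : ℝ → ℝ}

lemma dyadic_add_int (ψ : ℝ → ℝ) (j : ℕ) (k l : ℤ) (t : ℝ) :
    dyadic ψ j k (t + l) = dyadic ψ j (k - 2 ^ j * l) t := by
  simp only [dyadic]
  congr 2
  push_cast
  ring

lemma measurable_dyadic (hψ : Measurable ψ) (j : ℕ) (k : ℤ) : Measurable (dyadic ψ j k) := by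
  unfold dyadic
  fun_prop

/-- Dilation only shrinks the support, and the translation `k / 2^j` lies in `[0, 1]`; hence the
radius `R + 1`, uniform in `j`. -/
lemma dyadic_eq_zero {R : ℕ} (hR : ∀ x, (R : ℝ) < |x| → ψ x = 0) {j : ℕ} (k : Fin (2 ^ j)) {x : ℝ}
    (hx : (R : ℝ) + 1 < |x|) : dyadic ψ j ((k : ℕ) : ℤ) x = 0 := by
  rw [dyadic, hR, mul_zero]
  have h1 : (1 : ℝ) ≤ 2 ^ j := one_le_pow₀ (by norm_num)
  have h2 : ((k : ℕ) : ℝ) ≤ 2 ^ j := by exact_mod_cast k.2.le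
  have h3 : (0 : ℝ) ≤ (k : ℕ) := Nat.cast_nonneg _
  have h4 : (2 : ℝ) ^ j * |x| - 2 ^ j ≤ |2 ^ j * x - ((k : ℕ) : ℤ)| := by
    have := abs_sub_abs_le_abs_sub ((2 : ℝ) ^ j * x) ((k : ℕ) : ℤ)
    rw [abs_mul, abs_of_pos (by positivity : (0 : ℝ) < 2 ^ j)] at this
    push_cast at this ⊢
    rw [abs_of_nonneg h3] at this
    linarith
  have h5 : (0 : ℝ) ≤ R := Nat.cast_nonneg _
  nlinarith

/-- The periodized wavelet as a finite sum. -/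
noncomputable def finitePeriodized (ψ : ℝ → ℝ) (R j : ℕ) (k : Fin (2 ^ j)) (t : ℝ) : ℝ :=
  ∑ l ∈ Finset.Icc (-(R + 2 : ℤ)) (R + 2), dyadic ψ j ((k : ℕ) : ℤ) (t + l)

lemma dyadic_add_eq_zero {R : ℕ} (hR : ∀ x, (R : ℝ) < |x| → ψ x = 0) {j : ℕ} (k : Fin (2 ^ j))
    {t : ℝ} (ht : t ∈ Set.Icc (0 : ℝ) 1) {l : ℤ} (hl : l ∉ Finset.Icc (-(R + 2 : ℤ)) (R + 2)) :
    dyadic ψ j ((k : ℕ) : ℤ) (t + l) = 0 := by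
  refine dyadic_eq_zero hR k ?_
  have h1 : (R + 3 : ℤ) ≤ |l| := by
    rw [Finset.mem_Icc, not_and_or, not_le, not_le] at hl
    rcases hl with h | h
    · exact le_trans (by omega) (neg_le_abs l)
    · exact le_trans (by omega) (le_abs_self l)
  have h2 : (R + 3 : ℝ) ≤ |(l : ℝ)| := by exact_mod_cast h1
  have h3 := abs_sub_abs_le_abs_sub (l : ℝ) (-t)
  rw [sub_neg_eq_add, abs_neg, abs_of_nonneg ht.1, add_comm (l : ℝ)] at h3
  linarith [ht.2]

lemma periodized_eq_finitePeriodized {R : ℕ} (hR : ∀ x, (R : ℝ) < |x| → ψ x = 0) {j : ℕ}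
    (k : Fin (2 ^ j)) {t : ℝ} (ht : t ∈ Set.Icc (0 : ℝ) 1) :
    periodized ψ j k t = finitePeriodized ψ R j k t :=
  tsum_eq_sum fun _ hl => dyadic_add_eq_zero hR k ht hl

lemma measurable_finitePeriodized (hψ : Measurable ψ) (R j : ℕ) (k : Fin (2 ^ j)) :
    Measurable (finitePeriodized ψ R j k) := by
  have := measurable_dyadic hψ
  unfold finitePeriodized
  fun_prop

/-- Over all `k` and all periods `l`, the integers `k - 2^j l` are distinct, so the double sum runs
over distinct integer translates of `ψ` at one point. At most `2R + 1` of them are nonzero, so no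
factor `2^j` appears beyond the normalization. -/
lemma sum_abs_finitePeriodized_le {B : ℝ} (hB : ∀ x, |ψ x| ≤ B) {R : ℕ}
    (hR : ∀ x, (R : ℝ) < |x| → ψ x = 0) (j : ℕ) (t : ℝ) :
    ∑ k, |finitePeriodized ψ R j k t| ≤ Real.sqrt (2 ^ j) * (B * (2 * R + 1)) := by
  have hB0 : 0 ≤ B := (abs_nonneg _).trans (hB 0)
  set y : ℝ := 2 ^ j * t with hy
  set I := Finset.Icc ⌈y - R⌉ ⌊y + R⌋ with hI
  set S := (Finset.univ : Finset (Fin (2 ^ j))) ×ˢ Finset.Icc (-(R + 2 : ℤ)) (R + 2) with hS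
  set f : Fin (2 ^ j) × ℤ → ℤ := fun z => ((z.1 : ℕ) : ℤ) - 2 ^ j * z.2 with hf
  have hinj : Function.Injective f := by
    rintro ⟨k, l⟩ ⟨k', l'⟩ h
    simp only [hf] at h
    have hk : ((k : ℕ) : ℤ) < 2 ^ j := by exact_mod_cast k.2
    have hk' : ((k' : ℕ) : ℤ) < 2 ^ j := by exact_mod_cast k'.2
    have h1 : ((k : ℕ) : ℤ) % 2 ^ j = ((k' : ℕ) : ℤ) % 2 ^ j := by
      rw [show ((k : ℕ) : ℤ) = ((k' : ℕ) : ℤ) + 2 ^ j * (l - l') by linarith,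
        Int.add_mul_emod_self_left]
    rw [Int.emod_eq_of_lt (by positivity) hk, Int.emod_eq_of_lt (by positivity) hk'] at h1
    rw [h1] at h
    have h2 : (2 : ℤ) ^ j * l = 2 ^ j * l' := by linarith
    have h3 := mul_left_cancel₀ (by positivity) h2
    exact Prod.ext (Fin.ext (by exact_mod_cast h1)) h3
  have hterm : ∀ n : ℤ, |ψ (y - n)| ≤ if n ∈ I then B else 0 := by
    intro n
    split_ifs with h
    · exact hB _
    · rw [hR, abs_zero]
      rw [hI, Finset.mem_Icc, not_and_or, Int.ceil_le, Int.le_floor, not_le, not_le] at h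
      rcases h with h | h
      · exact lt_of_lt_of_le (by linarith) (le_abs_self _)
      · exact lt_of_lt_of_le (by linarith) (neg_le_abs _)
  have hcardI : (I.card : ℝ) ≤ 2 * R + 1 := by
    rw [hI, Int.card_Icc]
    have h1 := Int.floor_le (y + R)
    have h2 := Int.le_ceil (y - R)
    have h3 : ((⌊y + R⌋ + 1 - ⌈y - R⌉ : ℤ) : ℝ) ≤ 2 * R + 1 := by
      push_cast
      linarith
    have h4 : ((⌊y + R⌋ + 1 - ⌈y - R⌉).toNat : ℝ) =
        ((max (⌊y + R⌋ + 1 - ⌈y - R⌉) 0 : ℤ) : ℝ) := by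
      rw [← Int.toNat_eq_max]
      norm_cast
    rw [h4, Int.cast_max]
    exact max_le h3 (by push_cast; positivity)
  calc ∑ k, |finitePeriodized ψ R j k t|
      ≤ ∑ k : Fin (2 ^ j), ∑ l ∈ Finset.Icc (-(R + 2 : ℤ)) (R + 2), |dyadic ψ j ((k : ℕ) : ℤ) (t + l)| :=
        Finset.sum_le_sum fun k _ => Finset.abs_sum_le_sum_abs _ _
    _ = ∑ z ∈ S, Real.sqrt (2 ^ j) * |ψ (y - f z)| := by
        rw [hS, Finset.sum_product]
        refine Finset.sum_congr rfl fun k _ => Finset.sum_congr rfl fun l _ => ?_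
        rw [dyadic_add_int, dyadic, abs_mul, abs_of_nonneg (Real.sqrt_nonneg _)]
    _ = Real.sqrt (2 ^ j) * ∑ n ∈ S.image f, |ψ (y - n)| := by
        rw [← Finset.mul_sum, Finset.sum_image hinj.injOn]
    _ ≤ Real.sqrt (2 ^ j) * ∑ n ∈ S.image f, if n ∈ I then B else 0 := by
        gcongr with n
        exact hterm n
    _ ≤ Real.sqrt (2 ^ j) * (B * (2 * R + 1)) := by
        gcongr
        rw [← Finset.sum_filter, Finset.sum_const, nsmul_eq_mul, mul_comm]
        gcongr
        refine le_trans ?_ hcardI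
        exact_mod_cast Finset.card_le_card fun n hn => (Finset.mem_filter.1 hn).2

lemma integrable_of_bounded_of_support {f : ℝ → ℝ} (hf : Measurable f) {b r : ℝ}
    (hb : ∀ x, |f x| ≤ b) (hr : ∀ x, r < |x| → f x = 0) : Integrable f := by
  have h1 : IntegrableOn f (Set.Icc (-r) r) :=
    Measure.integrableOn_of_bounded (M := b) (by simp) hf.aestronglyMeasurable
      (Eventually.of_forall fun x => hb x)
  refine h1.integrable_of_forall_notMem_eq_zero fun x hx => hr x ?_
  by_contra h
  exact hx (abs_le.1 (not_lt.1 h))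

lemma abs_dyadic_le {B : ℝ} (hB : ∀ x, |ψ x| ≤ B) (j : ℕ) (k : ℤ) (x : ℝ) :
    |dyadic ψ j k x| ≤ Real.sqrt (2 ^ j) * B := by
  rw [dyadic, abs_mul, abs_of_nonneg (Real.sqrt_nonneg _)]
  gcongr
  exact hB _

/-- Unfolding: integrating the periodization over one period is integrating the original function
over the line. -/
lemma integral_Icc_finitePeriodized {B : ℝ} (hB : ∀ x, |ψ x| ≤ B) {R : ℕ}
    (hR : ∀ x, (R : ℝ) < |x| → ψ x = 0) (hψ : Measurable ψ) (h0 : ∫ x, ψ x = 0) (j : ℕ)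
    (k : Fin (2 ^ j)) : ∫ t in Set.Icc (0 : ℝ) 1, finitePeriodized ψ R j k t = 0 := by
  set D := dyadic ψ j ((k : ℕ) : ℤ) with hD
  have hDm : Measurable D := measurable_dyadic hψ j _
  have hDi : Integrable D := integrable_of_bounded_of_support hDm (abs_dyadic_le hB j _)
    fun x hx => dyadic_eq_zero hR k hx
  have hD0 : ∫ x, D x = 0 := by
    simp only [hD, dyadic]
    rw [integral_const_mul]
    have := Measure.integral_comp_mul_left (fun x => ψ (x - (((k : ℕ) : ℤ) : ℝ))) ((2 : ℝ) ^ j)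
    rw [this, integral_sub_right_eq_self (fun x => ψ x), h0]
    simp
  have hzero : ∀ l ∉ Finset.Icc (-(R + 2 : ℤ)) (R + 2), ∫ t in (0 : ℝ)..1, D (t + l) = 0 := by
    intro l hl
    rw [intervalIntegral.integral_congr (g := fun _ => 0), intervalIntegral.integral_zero]
    intro t ht
    rw [Set.uIcc_of_le zero_le_one] at ht
    exact dyadic_add_eq_zero hR k ht hl
  have hsum := (hDi.hasSum_intervalIntegral_comp_add_int).unique (hasSum_sum_of_ne_finset_zero hzero)
  rw [integral_Icc_eq_integral_Ioc, ← intervalIntegral.integral_of_le zero_le_one]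
  simp only [finitePeriodized]
  rw [intervalIntegral.integral_finsetSum, ← hsum, hD0]
  intro l _
  exact (hDi.comp_add_right (l : ℝ)).intervalIntegrable

/-- Unfolding again: the double sum over periods `l`, `m` is regrouped by `r = m - l`. Each `r`
contributes an inner product on the line of two wavelets, and only `r = 0` can contribute. -/
lemma integral_Icc_finitePeriodized_mul {B : ℝ} (hB : ∀ x, |ψ x| ≤ B) {R : ℕ}
    (hR : ∀ x, (R : ℝ) < |x| → ψ x = 0) (hψ : Measurable ψ)
    (horth : ∀ a b : ℕ × ℤ, ∫ x, dyadic ψ a.1 a.2 x * dyadic ψ b.1 b.2 x = if a = b then 1 else 0)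
    (j j' : ℕ) (k : Fin (2 ^ j)) (k' : Fin (2 ^ j')) :
    ∫ t in Set.Icc (0 : ℝ) 1, finitePeriodized ψ R j k t * finitePeriodized ψ R j' k' t =
      if j = j' ∧ (k : ℕ) = k' then 1 else 0 := by
  set L := Finset.Icc (-(R + 2 : ℤ)) (R + 2) with hL
  set D := dyadic ψ j ((k : ℕ) : ℤ) with hD
  set E := dyadic ψ j' ((k' : ℕ) : ℤ) with hE
  have hDm : Measurable D := measurable_dyadic hψ j _
  have hEm : Measurable E := measurable_dyadic hψ j' _
  have hDb := abs_dyadic_le hB j ((k : ℕ) : ℤ)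
  have hEb := abs_dyadic_le hB j' ((k' : ℕ) : ℤ)
  have hDs : ∀ x : ℝ, (R : ℝ) + 1 < |x| → D x = 0 := fun x hx => dyadic_eq_zero hR k hx
  have hDEi : ∀ r : ℤ, Integrable fun x => D x * E (x + r) := by
    intro r
    refine integrable_of_bounded_of_support (by fun_prop)
      (b := Real.sqrt (2 ^ j) * B * (Real.sqrt (2 ^ j') * B)) (r := R + 1) (fun x => ?_)
      fun x hx => by rw [hDs x hx, zero_mul]
    rw [abs_mul]
    exact mul_le_mul (hDb x) (hEb _) (abs_nonneg _) ((abs_nonneg _).trans (hDb x))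
  have hDE : ∀ r : ℤ, ∫ x, D x * E (x + r) = if (j, ((k : ℕ) : ℤ)) =
      (j', ((k' : ℕ) : ℤ) - 2 ^ j' * r) then 1 else 0 := by
    intro r
    simp only [hE, dyadic_add_int]
    have := horth (j, ((k : ℕ) : ℤ)) (j', ((k' : ℕ) : ℤ) - 2 ^ j' * r)
    rw [this]
  set I : ℤ → ℤ → ℝ := fun l m => ∫ t in (0 : ℝ)..1, D (t + l) * E (t + m) with hI
  have hIint : ∀ l m : ℤ, IntervalIntegrable (fun t => D (t + l) * E (t + m)) volume 0 1 := by
    intro l m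
    have := ((hDEi (m - l)).comp_add_right (l : ℝ)).intervalIntegrable (a := 0) (b := 1)
    convert this using 4
    push_cast
    ring
  have hI1 : ∀ l ∉ L, ∀ m, I l m = 0 := by
    intro l hl m
    simp only [hI]
    rw [intervalIntegral.integral_congr (g := fun _ => 0), intervalIntegral.integral_zero]
    intro t ht
    rw [Set.uIcc_of_le zero_le_one] at ht
    simp only [hD]
    rw [dyadic_add_eq_zero hR k ht hl, zero_mul]
  have hI2 : ∀ m ∉ L, ∀ l, I l m = 0 := by
    intro m hm l
    simp only [hI]
    rw [intervalIntegral.integral_congr (g := fun _ => 0), intervalIntegral.integral_zero]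
    intro t ht
    rw [Set.uIcc_of_le zero_le_one] at ht
    simp only [hE]
    rw [dyadic_add_eq_zero hR k' ht hm, mul_zero]
  have hrow : ∀ r : ℤ, ∑ l ∈ L, I l (l + r) = ∫ x, D x * E (x + r) := by
    intro r
    have h1 := (hDEi r).hasSum_intervalIntegral_comp_add_int
    have h2 : HasSum (fun l : ℤ => I l (l + r)) (∑ l ∈ L, I l (l + r)) :=
      hasSum_sum_of_ne_finset_zero fun l hl => hI1 l hl _
    have h3 : (fun l : ℤ => I l (l + r)) =
        fun l : ℤ => ∫ t in (0 : ℝ)..1, (fun x => D x * E (x + r)) (t + l) := by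
      ext l
      simp only [hI, Int.cast_add, add_assoc]
    refine h2.unique ?_
    rw [h3]
    exact h1
  have hcol : ∀ l : ℤ, HasSum (fun r => I l (l + r)) (∑ m ∈ L, I l m) := by
    intro l
    have h1 : HasSum (fun m => I l m) (∑ m ∈ L, I l m) :=
      hasSum_sum_of_ne_finset_zero fun m hm => hI2 m hm l
    rw [← (Equiv.addLeft l).hasSum_iff] at h1
    exact h1
  have htotal : HasSum (fun r : ℤ => ∫ x, D x * E (x + r)) (∑ l ∈ L, ∑ m ∈ L, I l m) := by
    simp_rw [← hrow]
    exact hasSum_sum fun l _ => hcol l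
  have hsingle : HasSum (fun r : ℤ => ∫ x, D x * E (x + r))
      (if j = j' ∧ (k : ℕ) = k' then 1 else 0) := by
    have h0 : ∫ x, D x * E (x + (0 : ℤ)) = if j = j' ∧ (k : ℕ) = k' then 1 else 0 := by
      rw [hDE]
      simp [Prod.ext_iff]
    rw [← h0]
    refine hasSum_single 0 fun r hr => ?_
    rw [hDE, if_neg]
    rintro h
    obtain ⟨rfl, h⟩ := Prod.mk.inj h
    have hk : ((k : ℕ) : ℤ) < 2 ^ j := by exact_mod_cast k.2
    have hk' : ((k' : ℕ) : ℤ) < 2 ^ j := by exact_mod_cast k'.2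
    have hpos : (0 : ℤ) < 2 ^ j := by positivity
    have hk0 : (0 : ℤ) ≤ (k : ℕ) := by positivity
    have hk0' : (0 : ℤ) ≤ (k' : ℕ) := by positivity
    -- Both `k` and `k'` lie in `[0, 2^j)`, so `k = k' - 2^j * r` is impossible for `r ≠ 0`.
    rcases lt_or_gt_of_ne hr with h1 | h1
    · nlinarith
    · nlinarith
  rw [hsingle.unique htotal, integral_Icc_eq_integral_Ioc,
    ← intervalIntegral.integral_of_le zero_le_one]
  simp only [finitePeriodized, Finset.sum_mul_sum]
  have hIsum : ∀ l : ℤ, IntervalIntegrable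
      (fun t => ∑ m ∈ L, D (t + l) * E (t + m)) volume 0 1 := by
    intro l
    have := IntervalIntegrable.sum L fun m _ => hIint l m
    rwa [show (∑ m ∈ L, fun t => D (t + l) * E (t + m)) =
      fun t => ∑ m ∈ L, D (t + l) * E (t + m) by ext; simp] at this
  rw [intervalIntegral.integral_finsetSum fun l _ => hIsum l]
  refine Finset.sum_congr rfl fun l _ => ?_
  rw [intervalIntegral.integral_finsetSum fun m _ => hIint l m]

/-- The Besov norm of a function whose wavelet coefficients vanish off the level `j`. -/
lemma besovNorm_le_of_level {f : ℝ → ℝ} {s γ A : ℝ} {p q : ℝ≥0∞} {j : ℕ} (hγ : 0 ≤ γ)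
    (h1 : ∀ k, |waveletCoeff ψ f j k| ≤ γ) (h2 : ∀ j' ≠ j, ∀ k, waveletCoeff ψ f j' k = 0)
    (hA : γ * 2 ^ ((j : ℝ) * (s + 1 / 2)) ≤ A) :
    besovNorm ψ s p q f ≤ ENNReal.ofReal A := by
  set c := (2 : ℝ) ^ ((j : ℝ) * (s + 1 / 2 - 1 / p.toReal)) *
    (eLpNorm (fun k : Fin (2 ^ j) => waveletCoeff ψ f j k) p Measure.count).toReal with hc
  have hfun : (fun j' : ℕ => (2 : ℝ) ^ ((j' : ℝ) * (s + 1 / 2 - 1 / p.toReal)) *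
      (eLpNorm (fun k : Fin (2 ^ j') => waveletCoeff ψ f j' k) p Measure.count).toReal) =
      Set.indicator {j} fun _ => c := by
    ext j'
    by_cases h : j' = j
    · subst h
      simp [hc]
    · have : (fun k : Fin (2 ^ j') => waveletCoeff ψ f j' k) = 0 := funext fun k => h2 j' h k
      rw [this, eLpNorm_zero]
      simp [h]
  have hc0 : 0 ≤ c := by positivity
  have hcA : c ≤ A := by
    refine le_trans ?_ hA
    -- The `ℓ^p` norm of `2^j` entries bounded by `γ` costs `2^{j/p}`, which cancels the `-1/p` in
    -- the Besov exponent. For `p = ∞`, `p.toReal = 0` and `1 / 0 = 0` give the correct factor `1`.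
    have hle : eLpNorm (fun k : Fin (2 ^ j) => waveletCoeff ψ f j k) p Measure.count ≤
        ENNReal.ofReal ((2 : ℝ) ^ ((j : ℝ) * (1 / p.toReal)) * γ) := by
      refine (eLpNorm_le_of_ae_bound (C := γ) (Eventually.of_forall fun k => h1 k)).trans ?_
      rw [ENNReal.ofReal_mul (by positivity)]
      gcongr
      rw [Measure.count_univ, ENat.card_eq_coe_fintype_card, Fintype.card_fin, Real.rpow_mul two_pos.le,
        Real.rpow_natCast, one_div,
        ← ENNReal.ofReal_rpow_of_nonneg (by positivity) (by positivity)]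
      refine le_of_eq ?_
      congr 1
      rw [ENNReal.ofReal_pow two_pos.le]
      simp
    have htr := ENNReal.toReal_mono ENNReal.ofReal_ne_top hle
    rw [ENNReal.toReal_ofReal (by positivity)] at htr
    calc c ≤ (2 : ℝ) ^ ((j : ℝ) * (s + 1 / 2 - 1 / p.toReal)) *
          ((2 : ℝ) ^ ((j : ℝ) * (1 / p.toReal)) * γ) := by
          rw [hc]
          gcongr
      _ = _ := by
          rw [← mul_assoc, ← Real.rpow_add two_pos, mul_comm]
          congr 2
          ring
  rw [besovNorm, hfun]
  refine (eLpNorm_indicator_const_le _ _).trans ?_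
  rw [Measure.count_singleton, ENNReal.one_rpow, mul_one, Real.enorm_eq_ofReal hc0]
  exact ENNReal.ofReal_le_ofReal hcA

/-- On every level there are orthonormal functions on the unit interval whose small linear
combinations are components in Besov balls. -/
lemma IsWaveletPair.exists_level_system {φ : ℝ → ℝ} (hw : IsWaveletPair φ ψ) {n : ℕ}
    (hn : HasVanishingMoments ψ n) (hn1 : 1 ≤ n) :
    ∃ (W : (j : ℕ) → Fin (2 ^ j) → ℝ → ℝ) (S : ℝ), 0 < S ∧
      (∀ j k, Measurable (W j k)) ∧ (∀ j k t, |W j k t| ≤ Real.sqrt (2 ^ j) * S) ∧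
      (∀ j k k', ∫ t in Set.Icc (0 : ℝ) 1, W j k t * W j k' t = if k = k' then 1 else 0) ∧
      ∀ (s : ℝ) (p q : ℝ≥0∞) (A M γ : ℝ) (j : ℕ) (c : Fin (2 ^ j) → ℝ), 0 ≤ γ →
        (∀ k, |c k| ≤ γ) → γ * 2 ^ ((j : ℝ) * (s + 1 / 2)) ≤ A → γ * (Real.sqrt (2 ^ j) * S) ≤ M →
        IsComponent ψ s p q A M fun t => ∑ k, c k * W j k t := by
  obtain ⟨B, hB⟩ := hw.bounded_wavelet
  obtain ⟨r, hr⟩ := hw.compactSupport_wavelet.isCompact.isBounded.subset_closedBall 0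
  obtain ⟨R, hrR⟩ := exists_nat_ge r
  have hR : ∀ x, (R : ℝ) < |x| → ψ x = 0 := by
    intro x hx
    by_contra h
    have := hr (subset_tsupport ψ h)
    rw [mem_closedBall_zero_iff, Real.norm_eq_abs] at this
    linarith
  have hψ := hw.measurable_wavelet
  have hB0 : 0 ≤ B := (abs_nonneg _).trans (hB 0)
  have h0 : ∫ x, ψ x = 0 := by simpa using hn 0 hn1
  have horth : ∀ a b : ℕ × ℤ, ∫ x, dyadic ψ a.1 a.2 x * dyadic ψ b.1 b.2 x =
      if a = b then 1 else 0 := by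
    intro a b
    simpa [waveletFamily] using hw.orthonormal (Sum.inr a) (Sum.inr b)
  have hfin := integral_Icc_finitePeriodized_mul hB hR hψ horth
  -- The added `1` makes `S` positive without a lower bound on `B`; `M / S` is used later.
  set S := B * (2 * R + 1) + 1 with hS
  have hsum : ∀ j t, ∑ k, |finitePeriodized ψ R j k t| ≤ Real.sqrt (2 ^ j) * S := fun j t =>
    (sum_abs_finitePeriodized_le hB hR j t).trans (by gcongr; linarith)
  have hb : ∀ j k t, |finitePeriodized ψ R j k t| ≤ Real.sqrt (2 ^ j) * S := fun j k t =>
    (Finset.single_le_sum (f := fun k => |finitePeriodized ψ R j k t|)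
      (fun k _ => abs_nonneg _) (Finset.mem_univ k)).trans (hsum j t)
  have hm := measurable_finitePeriodized hψ R
  refine ⟨finitePeriodized ψ R, S, by positivity, hm, hb, fun j k k' => ?_, ?_⟩
  · rw [hfin]
    simp [Fin.ext_iff]
  · intro s p q A M γ j c hγ hc hA hM
    have hi : ∀ (f : ℝ → ℝ) (b : ℝ), Measurable f → (∀ t, |f t| ≤ b) →
        IntegrableOn f (Set.Icc (0 : ℝ) 1) := fun f b hf hfb =>
      Measure.integrableOn_of_bounded (M := b) (by simp) hf.aestronglyMeasurable
        (Eventually.of_forall hfb)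
    have hfm : Measurable fun t => ∑ k, c k * finitePeriodized ψ R j k t := by
      have := hm j
      fun_prop
    have hfb : ∀ t, |∑ k, c k * finitePeriodized ψ R j k t| ≤ M := by
      intro t
      calc |∑ k, c k * finitePeriodized ψ R j k t|
          ≤ ∑ k, |c k * finitePeriodized ψ R j k t| := Finset.abs_sum_le_sum_abs _ _
        _ ≤ ∑ k, γ * |finitePeriodized ψ R j k t| := by
            refine Finset.sum_le_sum fun k _ => ?_
            rw [abs_mul]
            gcongr
            exact hc k
        _ ≤ M := by
            rw [← Finset.mul_sum]
            exact (mul_le_mul_of_nonneg_left (hsum j t) hγ).trans hM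
    have hcoeff : ∀ (j' : ℕ) (k' : Fin (2 ^ j')),
        waveletCoeff ψ (fun t => ∑ k, c k * finitePeriodized ψ R j k t) j' k' =
        ∑ k, c k * if j = j' ∧ (k : ℕ) = k' then 1 else 0 := by
      intro j' k'
      have hprod : ∀ k, IntegrableOn (fun t => c k *
          (finitePeriodized ψ R j k t * finitePeriodized ψ R j' k' t)) (Set.Icc 0 1) := by
        intro k
        refine (hi _ (Real.sqrt (2 ^ j) * S * (Real.sqrt (2 ^ j') * S))
          ((hm j k).mul (hm j' k')) fun t => ?_).const_mul _
        rw [Pi.mul_apply, abs_mul]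
        exact mul_le_mul (hb j k t) (hb j' k' t) (abs_nonneg _) (by positivity)
      have : ∀ t ∈ Set.Icc (0 : ℝ) 1, (∑ k, c k * finitePeriodized ψ R j k t) *
          periodized ψ j' k' t = ∑ k, c k *
            (finitePeriodized ψ R j k t * finitePeriodized ψ R j' k' t) := by
        intro t ht
        rw [periodized_eq_finitePeriodized hR k' ht, Finset.sum_mul]
        exact Finset.sum_congr rfl fun k _ => mul_assoc _ _ _
      rw [waveletCoeff, setIntegral_congr_fun measurableSet_Icc this,
        integral_finsetSum _ fun k _ => hprod k]
      refine Finset.sum_congr rfl fun k _ => ?_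
      rw [integral_const_mul, hfin]
    refine ⟨hfm, ?_, fun t _ => (le_abs_self _).trans (hfb t), ?_, ?_⟩
    · exact MemLp.of_bound hfm.aestronglyMeasurable M (Eventually.of_forall hfb)
    · rw [integral_finsetSum _ fun k _ => (hi _ _ (hm j k) (hb j k)).const_mul _]
      refine Finset.sum_eq_zero fun k _ => ?_
      rw [integral_const_mul, integral_Icc_finitePeriodized hB hR hψ h0, mul_zero]
    · refine besovNorm_le_of_level hγ (fun k => ?_) (fun j' hj' k => ?_) hA
      · rw [hcoeff]
        simpa [← Fin.ext_iff] using hc k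
      · rw [hcoeff]
        simp [Ne.symm hj']

end Wavelet

/-! ### Tuning level and amplitude to obtain the two rates -/

section Rates

lemma lintegral_comp_le_of_density {Ω : Type*} [MeasurableSpace Ω] {P : Measure Ω} {Y : Ω → ℝ}
    (hY : Measurable Y) {h : ℝ → ℝ} (hh : Measurable h) {m : ℝ}
    (hlaw : P.map Y = (volume.restrict (Set.Icc (0 : ℝ) 1)).withDensity fun t =>
      ENNReal.ofReal (h t))
    (hm : ∀ t ∈ Set.Ico (0 : ℝ) 1, h t ≤ m) {F : ℝ → ℝ≥0∞} (hF : Measurable F) :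
    ∫⁻ ω, F (Y ω) ∂P ≤ ENNReal.ofReal m * ∫⁻ t in Set.Icc (0 : ℝ) 1, F t := by
  rw [← lintegral_map hF hY, hlaw, lintegral_withDensity_eq_lintegral_mul _ (by fun_prop) hF,
    ← lintegral_const_mul _ hF]
  refine lintegral_mono_ae ?_
  -- The density is bounded only on `[0, 1)`; the endpoint is null.
  have hne : ∀ᵐ t : ℝ ∂(volume.restrict (Set.Icc (0 : ℝ) 1)), t ≠ 1 :=
    ae_restrict_of_ae (by simp [ae_iff])
  filter_upwards [hne, ae_restrict_mem measurableSet_Icc] with t h1 h2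
  simp only [Pi.mul_apply]
  gcongr
  exact hm t ⟨h2.1, lt_of_le_of_ne h2.2 h1⟩

lemma integral_unitSquare_fst (F : ℝ → ℝ) :
    ∫ z in unitSquare, F z.1 = ∫ t in Set.Icc (0 : ℝ) 1, F t := by
  have := setIntegral_prod_mul (μ := volume) (ν := volume) F (fun _ : ℝ => (1 : ℝ))
    (Set.Icc (0 : ℝ) 1) (Set.Icc (0 : ℝ) 1)
  simpa [Measure.volume_eq_prod] using this

lemma integral_unitSquare_snd (F : ℝ → ℝ) :
    ∫ z in unitSquare, F z.2 = ∫ t in Set.Icc (0 : ℝ) 1, F t := by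
  have := setIntegral_prod_mul (μ := volume) (ν := volume) (fun _ : ℝ => (1 : ℝ)) F
    (Set.Icc (0 : ℝ) 1) (Set.Icc (0 : ℝ) 1)
  simpa [Measure.volume_eq_prod] using this

/-- The rate as (number of coefficients) / `N`, the form in which Assouad's bound produces it. -/
lemma besovRate_eq {A s : ℝ} (hA : 0 < A) (hs : 0 < s) {N : ℕ} (hN : 0 < N) :
    besovRate A s N = (A ^ 2 * N) ^ (1 / (2 * s + 1)) / N := by
  have hN' : (0 : ℝ) < N := by exact_mod_cast hN
  have hx : 0 < A ^ 2 * N := by positivity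
  have h1 : (1 / (A ^ 2 * N)) ^ (2 * s / (2 * s + 1)) =
      (A ^ 2 * N) ^ (1 / (2 * s + 1)) / (A ^ 2 * N) := by
    rw [one_div, Real.inv_rpow hx.le, ← Real.rpow_neg hx.le]
    conv_rhs => rw [← Real.rpow_sub_one hx.ne']
    congr 1
    field_simp
    ring
  rw [besovRate, h1]
  field_simp

lemma tendsto_rpow_div_atTop {A s : ℝ} (hA : 0 < A) (hs : 0 < s) :
    Tendsto (fun N : ℕ => (A ^ 2 * N) ^ (1 / (2 * s + 1)) / N) atTop (𝓝 0) := by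
  have h1 : ∀ᶠ N : ℕ in atTop, (A ^ 2) ^ (1 / (2 * s + 1)) * (N : ℝ) ^ (-(2 * s / (2 * s + 1))) =
      (A ^ 2 * N) ^ (1 / (2 * s + 1)) / N := by
    filter_upwards [eventually_gt_atTop 0] with N hN
    have hN' : (0 : ℝ) < N := by exact_mod_cast hN
    rw [Real.mul_rpow (by positivity) hN'.le,
      mul_div_assoc ((A ^ 2) ^ (1 / (2 * s + 1))), ← Real.rpow_sub_one hN'.ne']
    congr 2
    field_simp
    ring
  have h2 : Tendsto (fun N : ℕ => (N : ℝ) ^ (-(2 * s / (2 * s + 1)))) atTop (𝓝 0) :=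
    (tendsto_rpow_neg_atTop (by positivity)).comp tendsto_natCast_atTop_atTop
  refine Tendsto.congr' h1 ?_
  simpa using h2.const_mul ((A ^ 2) ^ (1 / (2 * s + 1)))

variable {Ω : Type*} [MeasurableSpace Ω] {P : Measure Ω} [IsProbabilityMeasure P]
  {T X : ℕ → Ω → ℝ} {η : ℤ → Ω → ℝ} {ε : ℕ → Ω → ℝ}
  {h₁ h₂ : ℝ → ℝ} {α : ℝ} {a : ℕ → ℝ} {v : ℝ≥0} {κ σ : ℝ}

/-- Lower bound for the estimation of one component. -/
lemma IsLongMemoryModel.eventually_besovRate_le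
    (hM : IsLongMemoryModel P T X η ε h₁ h₂ α a v κ)
    (ha : IsLongMemoryFilter α a) (hσ : 0 < σ) {K : ℝ} (hK : 0 < K)
    (hQ : ∀ N : ℕ, ∀ w : Fin N → ℝ,
      w ⬝ᵥ w ≤ K * (w ⬝ᵥ (toeplitz (linearAutocov a v) N).mulVec w) ∧
      (∑ i, w i) ^ 2 ≤ K * (N : ℝ) ^ α * (w ⬝ᵥ (toeplitz (linearAutocov a v) N).mulVec w))
    {φ ψ : ℝ → ℝ} (hw : IsWaveletPair φ ψ) {n : ℕ} (hn : HasVanishingMoments ψ n) (hn1 : 1 ≤ n)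
    {s A M m : ℝ} {p q : ℝ≥0∞} (hs : 0 < s) (hA : 0 < A) (hM0 : 0 < M) (hm : 0 < m)
    {Θ : Set AdditiveFn} {π : ℝ × ℝ → ℝ} (hπ : Measurable π)
    (hπint : ∀ F : ℝ → ℝ, ∫ z in unitSquare, F (π z) = ∫ t in Set.Icc (0 : ℝ) 1, F t)
    (hdens : ∀ i, ∀ F : ℝ → ℝ≥0∞, Measurable F →
      ∫⁻ ω, F (π (T i ω, X i ω)) ∂P ≤ ENNReal.ofReal m * ∫⁻ t in Set.Icc (0 : ℝ) 1, F t)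
    {mk : (ℝ → ℝ) → AdditiveFn} (hmk : ∀ f z, (mk f).eval z = 1 + f (π z))
    (hmem : ∀ f, IsComponent ψ s p q A M f → mk f ∈ Θ) :
    ∀ᶠ N : ℕ in atTop, ENNReal.ofReal (min 1 (σ ^ 2 / (24 * K * m)) / 4 * besovRate A s N) ≤
      additiveMinimaxRisk P T X ε σ N Θ := by
  obtain ⟨W, S, hS, hWm, hWb, hWo, hWc⟩ := hw.exists_level_system hn hn1
  -- With `γ² = ρ / N`, the mean energy bound reads `3/2 * K * (2γ/σ)² * N * m = 6Kmρ/σ² ≤ 1/4`,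
  -- hence the `24`. The cap `1` ensures `γ² ≤ 1/N`, which suffices for the Besov ball.
  set ρ := min 1 (σ ^ 2 / (24 * K * m)) with hρ
  have hρ0 : 0 < ρ := lt_min one_pos (by positivity)
  have hx1 : ∀ᶠ N : ℕ in atTop, 1 ≤ (A ^ 2 * N) ^ (1 / (2 * s + 1)) := by
    have h1 : Tendsto (fun N : ℕ => A ^ 2 * (N : ℝ)) atTop atTop :=
      tendsto_natCast_atTop_atTop.const_mul_atTop (by positivity)
    filter_upwards [h1.eventually_ge_atTop 1] with N hN
    exact Real.one_le_rpow hN (by positivity)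
  -- The bound `M` affects only how large `N` must be: the sup norm of the perturbation is of order
  -- `√(x / N)`, which tends to zero.
  have hx2 : ∀ᶠ N : ℕ in atTop, (A ^ 2 * N) ^ (1 / (2 * s + 1)) / N < (M / S) ^ 2 :=
    (tendsto_rpow_div_atTop hA hs).eventually_lt_const (by positivity)
  filter_upwards [hx1, hx2, eventually_gt_atTop 0] with N hN1 hN2 hN
  have hN' : (0 : ℝ) < N := by exact_mod_cast hN
  rw [besovRate_eq hA hs hN]
  set x := (A ^ 2 * (N : ℝ)) ^ (1 / (2 * s + 1)) with hx
  -- The level satisfies `2^j ≤ x < 2^{j+1}`: the upper bound on `2^j` keeps the cube in the class,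
  -- and `2^j > x / 2` costs a factor `2` in the rate.
  obtain ⟨j, hj1, hj2⟩ := exists_nat_pow_near hN1 (one_lt_two : (1 : ℝ) < 2)
  set γ := Real.sqrt (ρ / N) with hγ
  have hγ2 : γ ^ 2 = ρ / N := Real.sq_sqrt (by positivity)
  have hγ0 : 0 ≤ γ := Real.sqrt_nonneg _
  have hγ1 : γ ^ 2 ≤ 1 / N := by
    rw [hγ2]
    gcongr
    exact min_le_left _ _
  have hcond1 : γ * 2 ^ ((j : ℝ) * (s + 1 / 2)) ≤ A := by
    have h1 : (2 : ℝ) ^ ((j : ℝ) * (s + 1 / 2)) ≤ x ^ (s + 1 / 2) := by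
      rw [Real.rpow_mul two_pos.le, Real.rpow_natCast]
      gcongr
    have h2 : (x ^ (s + 1 / 2)) ^ 2 = A ^ 2 * N := by
      rw [hx, ← Real.rpow_two, ← Real.rpow_mul (by positivity), ← Real.rpow_mul (by positivity)]
      rw [show 1 / (2 * s + 1) * ((s + 1 / 2) * 2) = 1 by field_simp, Real.rpow_one]
    refine (mul_le_mul_of_nonneg_left h1 hγ0).trans (abs_le_of_sq_le_sq' ?_ hA.le).2
    rw [mul_pow, h2]
    calc γ ^ 2 * (A ^ 2 * N) ≤ 1 / N * (A ^ 2 * N) := by gcongr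
      _ = A ^ 2 := by field_simp
  have hcond2 : γ * (Real.sqrt (2 ^ j) * S) ≤ M := by
    refine (abs_le_of_sq_le_sq' ?_ hM0.le).2
    rw [mul_pow, mul_pow, Real.sq_sqrt (by positivity : (0 : ℝ) ≤ 2 ^ j)]
    calc γ ^ 2 * (2 ^ j * S ^ 2) ≤ 1 / N * (x * S ^ 2) := by gcongr
      _ = x / N * S ^ 2 := by ring
      _ ≤ (M / S) ^ 2 * S ^ 2 := by gcongr
      _ = M ^ 2 := by field_simp
  have hWsq : ∀ k, ∫⁻ t in Set.Icc (0 : ℝ) 1, ENNReal.ofReal (W j k t ^ 2) = 1 := by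
    intro k
    rw [← ofReal_integral_eq_lintegral_ofReal ?_ (Eventually.of_forall fun t => sq_nonneg _)]
    · simp_rw [sq, hWo]
      simp
    · refine Measure.integrableOn_of_bounded (M := (Real.sqrt (2 ^ j) * S) ^ 2) (by simp)
        ((hWm j k).pow_const 2).aestronglyMeasurable (Eventually.of_forall fun t => ?_)
      rw [Real.norm_eq_abs, abs_pow]
      gcongr
      exact hWb j k t
  set Q : Fin (2 ^ j) → (Fin N → ℝ × ℝ) → ℝ :=
    fun k y => K * ∑ i, (2 * γ * W j k (π (y i)) / σ) ^ 2 with hQdef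
  have hWmj := hWm j
  have hmain := hM.le_additiveMinimaxRisk ha hσ (N := N) (Θ := Θ)
    (Ψ := fun k z => W j k (π z)) (fun k => (hWm j k).comp hπ)
    (b := Real.sqrt (2 ^ j) * S) (fun k z => hWb j k _)
    (fun k l => by rw [hπint fun t => W j k t * W j l t, hWo])
    (β := 1) (γ := γ) (θ := fun τ => mk fun t => ∑ k, γ * boolSign (τ k) * W j k t)
    (fun τ => hmem _ (hWc s p q A M γ j _ hγ0 (fun k => by
      rw [abs_mul, abs_boolSign, mul_one, abs_of_nonneg hγ0]) hcond1 hcond2))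
    (fun τ z => hmk _ _) (q := Q) (fun k => by fun_prop)
    (fun k y => by
      obtain ⟨u, hu1, hu2, hu3, -⟩ := exists_mulVec_eq_of_quadratic_lower_bounds hK
        (B := K * (N : ℝ) ^ α) (by positivity) (fun w => (hQ N w).1) (fun w => (hQ N w).2)
        (fun i => 2 * γ * W j k (π (y i)) / σ)
      refine ⟨u, hu1, hu2, hu3.trans (le_of_eq ?_)⟩
      simp only [hQdef, dotProduct, sq])
    (fun k => by
      have hTm := hM.measurable_T
      have hXm := hM.measurable_X
      have hWk := hWm j k
      have hpos : 0 ≤ 3 / 2 * K * (2 * γ / σ) ^ 2 := by positivity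
      have hexp : ∀ ω, ENNReal.ofReal (3 / 2 * Q k fun i => (T i ω, X i ω)) =
          ENNReal.ofReal (3 / 2 * K * (2 * γ / σ) ^ 2) *
            ∑ i : Fin N, ENNReal.ofReal (W j k (π (T i ω, X i ω)) ^ 2) := by
        intro ω
        rw [← ENNReal.ofReal_sum_of_nonneg fun i _ => sq_nonneg _, ← ENNReal.ofReal_mul hpos,
          Finset.mul_sum]
        simp only [hQdef, Finset.mul_sum]
        congr 1
        refine Finset.sum_congr rfl fun i _ => ?_
        ring
      simp_rw [hexp]
      rw [lintegral_const_mul _ (by fun_prop), lintegral_finsetSum _ fun i _ => by fun_prop]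
      calc ENNReal.ofReal (3 / 2 * K * (2 * γ / σ) ^ 2) *
            ∑ i : Fin N, ∫⁻ ω, ENNReal.ofReal (W j k (π (T i ω, X i ω)) ^ 2) ∂P
          ≤ ENNReal.ofReal (3 / 2 * K * (2 * γ / σ) ^ 2) * ∑ _i : Fin N, ENNReal.ofReal m := by
            gcongr with i
            have := hdens i (fun t => ENNReal.ofReal (W j k t ^ 2)) (by fun_prop)
            rwa [hWsq, mul_one] at this
        _ = ENNReal.ofReal (3 / 2 * K * (2 * γ / σ) ^ 2 * (N * m)) := by
            rw [Finset.sum_const, Finset.card_univ, Fintype.card_fin, nsmul_eq_mul,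
              ENNReal.ofReal_mul hpos, ENNReal.ofReal_mul hN'.le, ENNReal.ofReal_natCast]
        _ ≤ ENNReal.ofReal (1 / 4) := by
            refine ENNReal.ofReal_le_ofReal ?_
            have h1 : ρ ≤ σ ^ 2 / (24 * K * m) := min_le_right _ _
            rw [le_div_iff₀ (by positivity)] at h1
            have h2 : 3 / 2 * K * (2 * γ / σ) ^ 2 * (N * m) =
                ρ * (24 * K * m) / (4 * σ ^ 2) := by
              rw [div_pow, mul_pow, hγ2]
              field_simp
              ring
            rw [h2, div_le_div_iff₀ (by positivity) (by positivity)]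
            linarith)
  refine le_trans (ENNReal.ofReal_le_ofReal ?_) hmain
  rw [hγ2, Fintype.card_fin]
  push_cast
  rw [pow_succ] at hj2
  calc ρ / 4 * (x / N) = (x / 2) * (ρ / N) / 2 := by ring
    _ ≤ (2 ^ j) * (ρ / N) / 2 := by
      gcongr
      linarith

/-- Lower bound for the estimation of the mean under long memory. -/
lemma IsLongMemoryModel.eventually_rpow_neg_le
    (hM : IsLongMemoryModel P T X η ε h₁ h₂ α a v κ)
    (ha : IsLongMemoryFilter α a) (hσ : 0 < σ) {K : ℝ} (hK : 0 < K)
    (hQ : ∀ N : ℕ, ∀ w : Fin N → ℝ,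
      w ⬝ᵥ w ≤ K * (w ⬝ᵥ (toeplitz (linearAutocov a v) N).mulVec w) ∧
      (∑ i, w i) ^ 2 ≤ K * (N : ℝ) ^ α * (w ⬝ᵥ (toeplitz (linearAutocov a v) N).mulVec w))
    {Θ : Set AdditiveFn} (hmem : ∀ r : ℝ, r ≠ 0 → (⟨r, fun _ => 0, fun _ => 0⟩ : AdditiveFn) ∈ Θ) :
    ∀ᶠ N : ℕ in atTop, ENNReal.ofReal (min (1 / 4) (σ ^ 2 / (24 * K)) / 2 * (N : ℝ) ^ (-α)) ≤
      additiveMinimaxRisk P T X ε σ N Θ := by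
  -- The cap `1/4` gives `γ ≤ 1/2`, so the means `1 ± γ` stay nonzero; the other term bounds the
  -- energy `6Kρ/σ²` by `1/4`.
  set ρ := min (1 / 4) (σ ^ 2 / (24 * K)) with hρ
  have hρ0 : 0 < ρ := lt_min (by norm_num) (by positivity)
  filter_upwards [eventually_gt_atTop 0] with N hN
  have hN' : (0 : ℝ) < N := by exact_mod_cast hN
  have hN1 : (1 : ℝ) ≤ N := by exact_mod_cast hN
  have hNα : (0 : ℝ) < (N : ℝ) ^ (-α) := by positivity
  set γ := Real.sqrt (ρ * (N : ℝ) ^ (-α)) with hγ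
  have hγ2 : γ ^ 2 = ρ * (N : ℝ) ^ (-α) := Real.sq_sqrt (by positivity)
  have hγ0 : 0 ≤ γ := Real.sqrt_nonneg _
  have hγ1 : γ ≤ 1 / 2 := by
    refine (abs_le_of_sq_le_sq' ?_ (by norm_num)).2
    have h1 : (N : ℝ) ^ (-α) ≤ 1 := Real.rpow_le_one_of_one_le_of_nonpos hN1 (by linarith [ha.pos])
    have h2 : ρ ≤ 1 / 4 := min_le_left _ _
    rw [hγ2]
    nlinarith
  -- A cube with a single coordinate, `Ψ = 1`: only the overall mean varies, so the shift is
  -- constant and the `N^α` bound on the energy applies for every design.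
  have hmain := hM.le_additiveMinimaxRisk ha hσ (N := N) (Θ := Θ)
    (ι := Unit) (Ψ := fun _ _ => 1) (fun _ => measurable_const) (b := 1) (fun _ _ => by simp)
    (fun _ _ => by rw [integral_unitSquare_fst fun _ => 1 * 1]; simp)
    (β := 1) (γ := γ) (θ := fun τ => ⟨1 + γ * boolSign (τ ()), fun _ => 0, fun _ => 0⟩)
    (fun τ => hmem _ (by
      have h1 := abs_boolSign (τ ())
      have h2 := neg_abs_le (boolSign (τ ()))
      rw [h1] at h2
      have h3 : 0 < 1 + γ * boolSign (τ ()) := by nlinarith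
      exact h3.ne'))
    (fun τ z => by simp [AdditiveFn.eval])
    (q := fun _ _ => K * (N : ℝ) ^ α * (2 * γ * 1 / σ) ^ 2) (fun _ => measurable_const)
    (fun _ y => by
      obtain ⟨u, hu1, hu2, -, hu3⟩ := exists_mulVec_eq_of_quadratic_lower_bounds hK
        (B := K * (N : ℝ) ^ α) (by positivity) (fun w => (hQ N w).1) (fun w => (hQ N w).2)
        (fun _ => 2 * γ * 1 / σ)
      exact ⟨u, hu1, hu2, hu3 _ rfl⟩)
    (fun _ => by
      rw [lintegral_const, measure_univ, mul_one]
      refine ENNReal.ofReal_le_ofReal ?_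
      have h1 : ρ ≤ σ ^ 2 / (24 * K) := min_le_right _ _
      rw [le_div_iff₀ (by positivity)] at h1
      have h2 : 3 / 2 * (K * (N : ℝ) ^ α * (2 * γ * 1 / σ) ^ 2) =
          ρ * (24 * K) / (4 * σ ^ 2) := by
        rw [mul_one, div_pow, mul_pow, hγ2, Real.rpow_neg hN'.le]
        field_simp
        ring
      rw [h2, div_le_div_iff₀ (by positivity) (by positivity)]
      linarith)
  refine le_trans (ENNReal.ofReal_le_ofReal (le_of_eq ?_)) hmain
  rw [hγ2]
  simp
  ring

end Rates

/-! ### Assembly of the lower bound -/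

theorem theorem1
    (φ₁ ψ₁ φ₂ ψ₂ : ℝ → ℝ) (hψ₁ : IsWaveletPair φ₁ ψ₁) (hψ₂ : IsWaveletPair φ₂ ψ₂)
    (n₁ n₂ : ℕ) (hn₁ : HasVanishingMoments ψ₁ n₁) (hn₂ : HasVanishingMoments ψ₂ n₂)
    (s₁ s₂ : ℝ) (hs₁ : s₁ ≤ n₁) (hs₂ : s₂ ≤ n₂)
    (p q : ℝ≥0∞) (hp : 1 ≤ p) (hq : 1 ≤ q)
    (hs : max (1 / p.toReal) (1 / 2) ≤ min s₁ s₂)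
    (α : ℝ) (a : ℕ → ℝ) (ha : IsLongMemoryFilter α a) (v : ℝ≥0) (hv : 0 < v)
    (hspec : ∃ d : ℝ → ℝ, IsSpectralDensity (linearAutocov a v) d ∧ ∃ c > 0,
      ∀ᵐ u ∂(volume.restrict (Set.Icc (-Real.pi) Real.pi)), c * |u| ^ (α - 1) ≤ d u)
    (σ : ℝ) (hσ : 0 < σ)
    (m₁₁ m₁₂ m₂₁ m₂₂ : ℝ) (hm₁ : 0 < m₁₁) (hm₁' : m₁₁ ≤ m₁₂) (hm₂ : 0 < m₂₁)
    (hm₂' : m₂₁ ≤ m₂₂) :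
    ∃ C : ℝ, 0 < C ∧
      ∀ A₁ A₂ M₁ M₂ : ℝ, 0 < A₁ → 0 < A₂ → 0 < M₁ → 0 < M₂ →
      ∀ h₁ h₂ : ℝ → ℝ, Measurable h₁ → Measurable h₂ →
        (∀ t ∈ Set.Ico (0 : ℝ) 1, m₁₁ ≤ h₁ t ∧ h₁ t ≤ m₁₂) →
        (∀ x ∈ Set.Ico (0 : ℝ) 1, m₂₁ ≤ h₂ x ∧ h₂ x ≤ m₂₂) →
      ∀ (Ω : Type*) [MeasurableSpace Ω] (P : Measure Ω) [IsProbabilityMeasure P]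
        (T X : ℕ → Ω → ℝ) (η : ℤ → Ω → ℝ) (ε : ℕ → Ω → ℝ) (κ : ℝ),
        IsLongMemoryModel P T X η ε h₁ h₂ α a v κ →
      ∀ᶠ N : ℕ in atTop,
        ENNReal.ofReal (C * max (if s₂ < s₁ then besovRate A₂ s₂ N else besovRate A₁ s₁ N)
          ((N : ℝ) ^ (-α))) ≤
        additiveMinimaxRisk P T X ε σ N (besovClass ψ₁ ψ₂ s₁ s₂ p q A₁ A₂ M₁ M₂) := by
  obtain ⟨d, hd, c, hc, hdc⟩ := hspec
  obtain ⟨K, hK, hQ⟩ := hd.quadratic_lower_bounds ha.pos ha.lt_one hc hdc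
  have hs₁' : 1 / 2 ≤ s₁ := (le_max_right _ _).trans (hs.trans (min_le_left _ _))
  have hs₂' : 1 / 2 ≤ s₂ := (le_max_right _ _).trans (hs.trans (min_le_right _ _))
  -- One vanishing moment makes the perturbations integrate to zero, as the class requires.
  have hn₁1 : 1 ≤ n₁ := by
    have : (0 : ℝ) < n₁ := by linarith
    exact_mod_cast this
  have hn₂1 : 1 ≤ n₂ := by
    have : (0 : ℝ) < n₂ := by linarith
    exact_mod_cast this
  have hm₁₂ : 0 < m₁₂ := hm₁.trans_le hm₁'
  have hm₂₂ : 0 < m₂₂ := hm₂.trans_le hm₂'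
  set C₁ := min 1 (σ ^ 2 / (24 * K * m₁₂)) / 4 with hC₁
  set C₂ := min 1 (σ ^ 2 / (24 * K * m₂₂)) / 4 with hC₂
  set C₀ := min (1 / 4) (σ ^ 2 / (24 * K)) / 2 with hC₀
  have hC₁0 : 0 < C₁ := div_pos (lt_min one_pos (by positivity)) (by norm_num)
  have hC₂0 : 0 < C₂ := div_pos (lt_min one_pos (by positivity)) (by norm_num)
  have hC₀0 : 0 < C₀ := div_pos (lt_min (by norm_num) (by positivity)) (by norm_num)
  -- The constant involves only `σ`, the spectral constant `K` and the upper design bounds; it is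
  -- fixed before the radii, the bounds `M₁`, `M₂` and the densities.
  refine ⟨min C₀ (min C₁ C₂), lt_min hC₀0 (lt_min hC₁0 hC₂0), ?_⟩
  intro A₁ A₂ M₁ M₂ hA₁ hA₂ hM₁ hM₂ h₁ h₂ hh₁ hh₂ hb₁ hb₂ Ω _ P _ T X η ε κ hM
  -- The component that is not perturbed is kept at zero, the case of vanishing coefficients at
  -- level `0`.
  have hzero : ∀ {φ ψ : ℝ → ℝ} (_ : IsWaveletPair φ ψ) {n : ℕ} (_ : HasVanishingMoments ψ n)
      (_ : 1 ≤ n) {s A M : ℝ} (_ : 0 < A) (_ : 0 < M), IsComponent ψ s p q A M fun _ => 0 := by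
    intro φ ψ hw n hn hn1 s A M hA hM
    obtain ⟨W, S, -, -, -, -, hWc⟩ := hw.exists_level_system hn hn1
    simpa using hWc s p q A M 0 0 0 le_rfl (by simp) (by simpa using hA.le) (by simpa using hM.le)
  have hz₁ := hzero hψ₁ hn₁ hn₁1 (s := s₁) hA₁ hM₁
  have hz₂ := hzero hψ₂ hn₂ hn₂1 (s := s₂) hA₂ hM₂
  have hmean := hM.eventually_rpow_neg_le ha hσ hK hQ
    (Θ := besovClass ψ₁ ψ₂ s₁ s₂ p q A₁ A₂ M₁ M₂) fun r hr => ⟨hr, hz₁, hz₂⟩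
  have hfirst := hM.eventually_besovRate_le ha hσ hK hQ hψ₁ hn₁ hn₁1 (s := s₁) (p := p) (q := q)
    (by linarith) hA₁ hM₁ hm₁₂ (Θ := besovClass ψ₁ ψ₂ s₁ s₂ p q A₁ A₂ M₁ M₂) measurable_fst
    integral_unitSquare_fst
    (fun i F hF => lintegral_comp_le_of_density (hM.measurable_T i) hh₁ (hM.law_T i)
      (fun t ht => (hb₁ t ht).2) hF)
    (mk := fun f => ⟨1, f, fun _ => 0⟩) (fun f z => by simp [AdditiveFn.eval])
    fun f hf => ⟨one_ne_zero, hf, hz₂⟩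
  have hsecond := hM.eventually_besovRate_le ha hσ hK hQ hψ₂ hn₂ hn₂1 (s := s₂) (p := p) (q := q)
    (by linarith) hA₂ hM₂ hm₂₂ (Θ := besovClass ψ₁ ψ₂ s₁ s₂ p q A₁ A₂ M₁ M₂) measurable_snd
    integral_unitSquare_snd
    (fun i F hF => lintegral_comp_le_of_density (hM.measurable_X i) hh₂ (hM.law_X i)
      (fun t ht => (hb₂ t ht).2) hF)
    (mk := fun f => ⟨1, fun _ => 0, f⟩) (fun f z => by simp [AdditiveFn.eval])
    fun f hf => ⟨one_ne_zero, hz₁, hf⟩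
  filter_upwards [hmean, hfirst, hsecond] with N e₀ e₁ e₂
  have hrate : ∀ A s : ℝ, 0 ≤ besovRate A s N := fun A s => by
    unfold besovRate
    positivity
  rw [mul_max_of_nonneg _ _ (le_min hC₀0.le (le_min hC₁0.le hC₂0.le)), ENNReal.ofReal_max]
  refine max_le ?_ ((ENNReal.ofReal_le_ofReal ?_).trans e₀)
  · split_ifs
    · refine (ENNReal.ofReal_le_ofReal ?_).trans e₂
      exact mul_le_mul_of_nonneg_right ((min_le_right _ _).trans (min_le_right _ _)) (hrate _ _)
    · refine (ENNReal.ofReal_le_ofReal ?_).trans e₁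
      exact mul_le_mul_of_nonneg_right ((min_le_right _ _).trans (min_le_left _ _)) (hrate _ _)
  · exact mul_le_mul_of_nonneg_right (min_le_left _ _) (by positivity)
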